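/- **Lemma 1.** A server holds $N$ files $W_1,\dots,W_N$ of $F$ bits each and serves $K\ge 2$ users over a shared error-free link, where $K$ divides $\binom K2$ (i.e. $K$ is odd). Let $0\le N_h\le N$; files $1,\dots,N_h$ are called high-level, the others low-level. Each file is divided into $\binom K2$ disjoint sub-files $W_{n,I}$ of equal size $b=F/\binom K2\ge 1$ bits, indexed by the sets $I\subseteq[K]$, $|I|=2$. *Placement of the $\mathrm{CL}(2,1)$ scheme.* If $n\le N_h$, then $W_{n,I}$ is cached by the two users in $I$. If $n>N_h$, then the sub-files of $W_n$ are divided arbitrarily into $K$ disjoint classes of equal size, and each user caches a different class. *Delivery of the $\mathrm{CL}(2,1)$ scheme.* For a demand vector $\mathbf d\in[N]^K$ let $\mathcal K^h,\mathcal K^l$ be the sets of users requesting high-level and low-level files, and $k^h=|\mathcal K^h|$, $k^l=|\mathcal K^l|$. For users $r,c$ let $A_{r,c}$ be the set of sub-files that $r$ requests and does not cache and that $c$ caches. *Level-1 delivery* within a set of users means: for every pair $j\ne k$ of them, match $A_{j,k}$ and $A_{k,j}$ one to one and send the XOR of each matched pair. If $k^h\ge2$, the messages are sent in four steps. (1)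 For each $\mathcal S\subseteq\mathcal K^h$ with $|\mathcal S|=3$, send $\bigoplus_{s\in\mathcal S}W_{d_s,\mathcal S\setminus\{s\}}$. (2) Level-1 delivery within $\mathcal K^l$. (3) For $i\in\mathcal K^h$, the set of index sets of the sub-files that $i$ requests and that are cached by low-level users only (it is the same for all $i$) is partitioned, in the same way for all $i$, into parts $\Lambda_{i,j}\subseteq A_{i,j}$, $j\in\mathcal K^l$, whose sizes differ by at most one; with $\Omega_{i,j}$ the set of sub-files in $A_{i,j}$ that are also cached by a high-level user, and some $\Delta_{i,j}\subseteq\Omega_{i,j}$, the sets $\Lambda_{i,j}\cup(\Omega_{i,j}\setminus\Delta_{i,j})$ and $A_{j,i}$ are matched one to one for all $i\in\mathcal K^h$, $j\in\mathcal K^l$, and the XOR of each matched pair is sent. (4) The sub-files in the sets $\Delta_{i,j}$, each taken once for the user $i$ that needs it, are partitioned into messages, each the XOR of two sub-files needed by two different high-level users each of whom caches the sub-file needed by the other, except for at most one message that is a single sub-file. If $k^h\le1$, the requested high-level file, if there is one, is treated as a low-level file: of the two cached copies of each of its sub-files only one is used, in such a way that every user contributes equally many sub-files; then level-1 delivery within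 $[K]$ is used. *Claim.* Such placements exist. For each of them, every user caches exactly $M(N_h,N,2,1)\,F$ bits, where $M(N_h,N,t,1)=\frac{N_h(t-1)+N}{K}$. For every demand vector $\mathbf d$, the total number of pairs (user, requested sub-file not cached by that user) is $$L(\mathbf d)=(K-1)\Big[\tfrac{K^2}{2}-k^h-\tfrac{k^l}{2}\Big],$$ and there is a delivery of the above form from which, together with its cache content, every user recovers the file it requests (for all contents of the files), and whose rate (number of transmitted bits divided by $F$) is $$R(\mathbf d)=\begin{cases}\dfrac{\binom{k^h}{3}+\Big\lceil\big(L(\mathbf d)-3\binom{k^h}{3}\big)/2\Big\rceil}{\binom K2},& k^h\ge2,\\[2ex] \dfrac{K-1}{2},& k^h<2.\end{cases}$$ -/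

import Mathlib

namespace CL21

/-- Sub-file indices: the two-element subsets of the set of users. -/
abbrev Pair (K : ℕ) := {I : Finset (Fin K) // I.card = 2}

/-- A library of `N` files of `F` bits each. -/
abbrev Library (N F : ℕ) := Fin N → Fin F → ZMod 2

/-- A sub-file level (uncoded) placement: `P n I` is the set of users that cache the sub-file of
file `n` with index `I`. -/
abbrev Placement (K N : ℕ) := Fin N → Pair K → Finset (Fin K)

/-- The pair `(s, I)` stands for the sub-file with index `I` of the file requested by user `s`;
a message is the XOR of the sub-files that it lists. -/
abbrev Message (K : ℕ) := Finset (Fin K × Pair K)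

variable {K N : ℕ}

/-- Every sub-file of file `n` is cached by exactly one user, and all users cache the same number
of sub-files of `n`. -/
def EvenlySplit (P : Placement K N) (n : Fin N) : Prop :=
  (∀ I, (P n I).card = 1) ∧
    ∀ u : Fin K, K * (Finset.univ.filter fun I : Pair K => u ∈ P n I).card = K.choose 2

/-- The placement phase: the first `Nh` files (the high-level ones) are cached at level 2, all
other files (the low-level ones) are evenly split. -/
def IsCL21Placement (Nh : ℕ) (P : Placement K N) : Prop :=
  (∀ n : Fin N, n.val < Nh → ∀ I, P n I = I.1) ∧ ∀ n : Fin N, Nh ≤ n.val → EvenlySplit P n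

/-- The set of bits (file, position in the file) in the cache of user `u`. The bijection `split`
divides each file of `F` bits into disjoint sub-files of `b` bits. -/
def cachedBits {F b : ℕ} (split : Fin F ≃ Pair K × Fin b) (P : Placement K N) (u : Fin K) :
    Finset (Fin N × Fin F) :=
  Finset.univ.filter fun x => u ∈ P x.1 (split x.2).1

/-- The cache size `M(Nh, N, t, 1)`, in units of the file size. -/
def cacheSize (K Nh N t : ℕ) : ℚ := (Nh * ((t : ℚ) - 1) + N) / K

/-- High-level users. -/
def highUsers (Nh : ℕ) (d : Fin K → Fin N) : Finset (Fin K) :=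
  Finset.univ.filter fun u => (d u).val < Nh

/-- Low-level users. -/
def lowUsers (Nh : ℕ) (d : Fin K → Fin N) : Finset (Fin K) :=
  Finset.univ.filter fun u => Nh ≤ (d u).val

/-- Indices of the sub-files that user `u` requests and does not cache. -/
def missing (P : Placement K N) (d : Fin K → Fin N) (u : Fin K) : Finset (Pair K) :=
  Finset.univ.filter fun I => u ∉ P (d u) I

/-- Indices of the sub-files that user `r` requests and misses and that user `c` caches. -/
def avail (P : Placement K N) (d : Fin K → Fin N) (r c : Fin K) : Finset (Pair K) :=
  (missing P d r).filter fun I => c ∈ P (d r) I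

/-- `Ω i j`: missing sub-files of user `i` that are cached by user `j` and by a high-level user. -/
def Omega (Nh : ℕ) (P : Placement K N) (d : Fin K → Fin N) (i j : Fin K) : Finset (Pair K) :=
  (avail P d i j).filter fun I => ∃ k ∈ highUsers Nh d, k ∈ P (d i) I

/-- `Λ i`: missing sub-files of user `i` that are cached by low-level users only. -/
def Lam (Nh : ℕ) (P : Placement K N) (d : Fin K → Fin N) (i : Fin K) : Finset (Pair K) :=
  (missing P d i).filter fun I => P (d i) I ⊆ lowUsers Nh d

/-- Level-2 coded delivery within a set `A` of users: for every three-element `S ⊆ A`, the XOR over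
`s ∈ S` of the sub-file with index `S \ {s}` requested by `s`. -/
def tripleMessages (A : Finset (Fin K)) : Finset (Message K) :=
  (A.powersetCard 3).image fun S => Finset.univ.filter fun x => x.1 ∈ S ∧ x.2.1 = S.erase x.1

/-- Level-1 coded delivery within a set `A` of users: for all `j < k` in `A`, the sub-files that `j`
needs from `k` and those that `k` needs from `j` are matched one to one and XORed. -/
def IsLevelOneDelivery (P : Placement K N) (d : Fin K → Fin N) (A : Finset (Fin K))
    (D : Finset (Message K)) : Prop :=
  ∃ e : Fin K → Fin K → Pair K → Pair K,
    (∀ j ∈ A, ∀ k ∈ A, j < k →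
      Set.BijOn (e j k) (avail P d j k : Set (Pair K)) (avail P d k j : Set (Pair K))) ∧
    ∀ m, m ∈ D ↔ ∃ j ∈ A, ∃ k ∈ A, j < k ∧ ∃ I ∈ avail P d j k, m = {(j, I), (k, e j k I)}

/-- A partition, the same for all high-level users `i`, of `Λ i` into parts `Lp j` indexed by the
low-level users `j`, with sub-files in `Lp j` cached by `j` and sizes that differ by at most one. -/
def IsLamPartition (Nh : ℕ) (P : Placement K N) (d : Fin K → Fin N)
    (Lp : Fin K → Finset (Pair K)) : Prop :=
  (∀ i ∈ highUsers Nh d, (lowUsers Nh d).biUnion Lp = Lam Nh P d i ∧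
    ∀ j ∈ lowUsers Nh d, Lp j ⊆ avail P d i j) ∧
  (∀ j ∈ lowUsers Nh d, ∀ k ∈ lowUsers Nh d, j ≠ k → Disjoint (Lp j) (Lp k)) ∧
  ∀ j ∈ lowUsers Nh d, ∀ k ∈ lowUsers Nh d, (Lp j).card ≤ (Lp k).card + 1

/-- Cross-level delivery: for each high-level `i` and low-level `j`, the sub-files in `Fs i j`
(for `i`) are matched one to one with those that `j` needs and `i` caches, and XORed. -/
def IsCrossDelivery (Nh : ℕ) (P : Placement K N) (d : Fin K → Fin N)
    (Fs : Fin K → Fin K → Finset (Pair K)) (D : Finset (Message K)) : Prop :=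
  ∃ g : Fin K → Fin K → Pair K → Pair K,
    (∀ i ∈ highUsers Nh d, ∀ j ∈ lowUsers Nh d,
      Set.BijOn (g i j) (Fs i j : Set (Pair K)) (avail P d j i : Set (Pair K))) ∧
    ∀ m, m ∈ D ↔ ∃ i ∈ highUsers Nh d, ∃ j ∈ lowUsers Nh d, ∃ I ∈ Fs i j,
      m = {(i, I), (j, g i j I)}

/-- Delivery of the sub-files in the sets `Δ i j` to the high-level users: these sub-files are
partitioned into messages, each of which is the XOR of two sub-files for two high-level users that
cache each other's sub-file, except for at most one unicast message. -/
def IsResidualDelivery (Nh : ℕ) (P : Placement K N) (d : Fin K → Fin N)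
    (Δ : Fin K → Fin K → Finset (Pair K)) (D : Finset (Message K)) : Prop :=
  (∀ x, (∃ m ∈ D, x ∈ m) ↔ x.1 ∈ highUsers Nh d ∧ ∃ j ∈ lowUsers Nh d, x.2 ∈ Δ x.1 j) ∧
  (∀ m ∈ D, ∀ m' ∈ D, m ≠ m' → Disjoint m m') ∧
  (∀ m ∈ D, (∃ x, m = {x}) ∨
    ∃ i ∈ highUsers Nh d, ∃ k ∈ highUsers Nh d, i ≠ k ∧
      ∃ I ∈ avail P d i k, ∃ I' ∈ avail P d k i, m = {(i, I), (k, I')}) ∧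
  (D.filter fun m => m.card = 1).card ≤ 1

/-- The four-step delivery phase, used when there are at least two high-level users. -/
def IsFourStepDelivery (Nh : ℕ) (P : Placement K N) (d : Fin K → Fin N)
    (D : Finset (Message K)) : Prop :=
  ∃ D₂ D₃ D₄ : Finset (Message K),
    ∃ (Lp : Fin K → Finset (Pair K)) (Δ : Fin K → Fin K → Finset (Pair K)),
      D = tripleMessages (highUsers Nh d) ∪ D₂ ∪ D₃ ∪ D₄ ∧
      IsLevelOneDelivery P d (lowUsers Nh d) D₂ ∧
      IsLamPartition Nh P d Lp ∧
      (∀ i ∈ highUsers Nh d, ∀ j ∈ lowUsers Nh d, Δ i j ⊆ Omega Nh P d i j) ∧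
      IsCrossDelivery Nh P d (fun i j => Lp j ∪ (Omega Nh P d i j \ Δ i j)) D₃ ∧
      IsResidualDelivery Nh P d Δ D₄

/-- Delivery when there is at most one high-level user: the requested high-level file, if any, is
treated as a low-level file (part of its cached copies is ignored), and level-1 coded delivery is
used for all users. -/
def IsFallbackDelivery (P : Placement K N) (d : Fin K → Fin N) (D : Finset (Message K)) : Prop :=
  ∃ P' : Placement K N, (∀ n I, P' n I ⊆ P n I) ∧ (∀ u, EvenlySplit P' (d u)) ∧
    IsLevelOneDelivery P' d Finset.univ D

/-- The delivery phase of the scheme for the demand vector `d`. -/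
def IsCL21Delivery (Nh : ℕ) (P : Placement K N) (d : Fin K → Fin N)
    (D : Finset (Message K)) : Prop :=
  (2 ≤ (highUsers Nh d).card → IsFourStepDelivery Nh P d D) ∧
    ((highUsers Nh d).card < 2 → IsFallbackDelivery P d D)

/-- The `b` bits sent over the shared link for the message `m`. -/
def transmit {F b : ℕ} (split : Fin F ≃ Pair K × Fin b) (d : Fin K → Fin N) (W : Library N F)
    (m : Message K) : Fin b → ZMod 2 :=
  fun c => ∑ x ∈ m, W (d x.1) (split.symm (x.2, c))

/-- Every user recovers the file it requests from its cache content and the messages in `D`,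
whatever the contents of the library. -/
def Decodable {F b : ℕ} (split : Fin F ≃ Pair K × Fin b) (P : Placement K N) (d : Fin K → Fin N)
    (D : Finset (Message K)) : Prop :=
  ∀ u : Fin K, ∃ ψ : (cachedBits split P u → ZMod 2) → (D → Fin b → ZMod 2) → (Fin F → ZMod 2),
    ∀ W : Library N F,
      ψ (fun x => W x.1.1 x.1.2) (fun m => transmit split d W m.1) = W (d u)

/-- Number of transmitted bits, normalized by the file size. -/
def deliveryRate (F b : ℕ) (D : Finset (Message K)) : ℚ := (D.card * b : ℚ) / F

/-- The expression `L(d)`, in terms of the numbers of high-level and low-level users. -/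
def totalMissing (K kh kl : ℕ) : ℚ := ((K : ℚ) - 1) * ((K : ℚ) ^ 2 / 2 - kh - (kl : ℚ) / 2)

/-- The expression `R(d)`. -/
def cl21Rate (K kh kl : ℕ) : ℚ :=
  if 2 ≤ kh then
    ((kh.choose 3 : ℚ) + (⌈(totalMissing K kh kl - 3 * (kh.choose 3 : ℚ)) / 2⌉ : ℤ)) / K.choose 2
  else ((K : ℚ) - 1) / 2

end CL21

/-
In every message, each listed sub-file is cached by all the other users listed, so a user cancels
what it caches and reads its own request: decoding is automatic, and only the number of messages
matters.

Write `K = 2 * q + 1`. A low-level user exchanges exactly `q` sub-files with every other user. The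
sets `Λ i j` come from a nearly balanced tournament on the low-level users, which decides for each
pair `{j, k}` which of the two serves the sub-file `{j, k}`. Then `δ j` sub-files `{j, k}`, with `k`
high-level, are left over for a high-level user `i` and must reach it from `k`: for each `j` the
choices form a digraph on the high-level users of constant out-degree `δ j`, and two opposite arcs,
possibly for different `j`, are one exchange.

A circulant digraph on `m` vertices of degree `δ` can be chosen symmetric unless `m` and `δ` are
both odd. In that case the arcs `i → i + 1` or the arcs `i → i - 1` are added to a symmetric one;
two such `j` with opposite signs cancel. If the number of such `j` is odd, the last one uses a
nearly perfect matching instead, which leaves a single unpaired arc: it is the only unicast message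
and accounts for the ceiling in the rate.
-/

namespace CL21

open Finset

variable {K N : ℕ}

section Pairs

variable {I : Pair K} {u v : Fin K} {L B C : Finset (Fin K)}

lemma Pair.eq_pair (hu : u ∈ I.1) (hv : v ∈ I.1) (huv : u ≠ v) : I.1 = {u, v} :=
  (eq_of_subset_of_card_le (insert_subset hu (singleton_subset_iff.2 hv))
    (by rw [I.2, card_pair huv])).symm

lemma Pair.exists_eq_pair (hu : u ∈ I.1) : ∃ v, I.1 = {u, v} := by
  obtain ⟨v, hv, hvu⟩ := exists_mem_ne (by rw [I.2]; norm_num) u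
  exact ⟨v, Pair.eq_pair hu hv hvu.symm⟩

lemma Pair.ne_of_eq_pair (hI : I.1 = {u, v}) : u ≠ v := by
  rintro rfl
  simpa [hI] using I.2

lemma Pair.subset_or_subset_compl_or_exists_eq_pair (I : Pair K) (L : Finset (Fin K)) :
    I.1 ⊆ L ∨ I.1 ⊆ Lᶜ ∨ ∃ j ∈ L, ∃ k ∉ L, I.1 = {j, k} := by
  by_cases hL : I.1 ⊆ L
  · exact Or.inl hL
  obtain ⟨k, hk, hkL⟩ := not_subset.1 hL
  obtain ⟨j, hI⟩ := Pair.exists_eq_pair hk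
  by_cases hj : j ∈ L
  · exact Or.inr (Or.inr ⟨j, hj, k, hkL, by rw [hI, pair_comm]⟩)
  · exact Or.inr (Or.inl (by simp [hI, insert_subset_iff, hj, hkL]))

lemma card_univ_pair : #(univ : Finset (Pair K)) = K.choose 2 := by
  rw [card_univ, Fintype.card_finset_len, Fintype.card_fin]

/-- The star with centre `v` and set of leaves `B` in the complete graph on the set of users. -/
def star (v : Fin K) (B : Finset (Fin K)) : Finset (Pair K) :=
  {I | ∃ k ∈ B, I.1 = {v, k}}

lemma mem_star : I ∈ star v B ↔ ∃ k ∈ B, I.1 = {v, k} := mem_filter_univ _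

lemma mem_star_of_eq_pair {j k : Fin K} (hI : I.1 = {j, k}) :
    I ∈ star v B ↔ (v = j ∧ k ∈ B) ∨ (v = k ∧ j ∈ B) := by
  have hjk := Pair.ne_of_eq_pair hI
  simp only [mem_star, hI, ← coe_inj, coe_pair, Set.pair_eq_pair_iff]
  grind

lemma star_sdiff (v : Fin K) (B C : Finset (Fin K)) : star v B \ star v C = star v (B \ C) := by
  ext I
  by_cases hv : v ∈ I.1
  · obtain ⟨k, hI⟩ := Pair.exists_eq_pair hv
    have := Pair.ne_of_eq_pair hI
    simp only [mem_sdiff, mem_star_of_eq_pair hI]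
    grind
  · simp only [mem_sdiff, mem_star]
    grind

lemma card_star (hv : v ∉ B) : #(star v B) = #B := by
  have hne : ∀ k ∈ B, v ≠ k := fun k hk h => hv (h ▸ hk)
  refine (card_bij (fun k hk => ⟨{v, k}, card_pair (hne k hk)⟩) ?_ ?_ ?_).symm
  · exact fun k hk => mem_star.2 ⟨k, hk, rfl⟩
  · intro k hk k' _ h
    have hmem : k ∈ ({v, k'} : Finset (Fin K)) := Subtype.mk.inj h ▸ by simp
    simpa [(hne k hk).symm] using hmem
  · intro I hI
    obtain ⟨k, hk, h⟩ := mem_star.1 hI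
    exact ⟨k, hk, Subtype.ext h.symm⟩

lemma card_pairs_mem (u : Fin K) : #{I : Pair K | u ∈ I.1} = K - 1 := by
  have hstar : ({I | u ∈ I.1} : Finset (Pair K)) = star u (univ.erase u) := by
    ext I
    rw [mem_filter_univ, mem_star]
    refine ⟨fun hu => ?_, fun ⟨v, _, hI⟩ => by simp [hI]⟩
    obtain ⟨v, hI⟩ := Pair.exists_eq_pair hu
    exact ⟨v, mem_erase.2 ⟨(Pair.ne_of_eq_pair hI).symm, mem_univ v⟩, hI⟩
  rw [hstar, card_star (notMem_erase u univ), card_erase_of_mem (mem_univ u), card_univ,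
    Fintype.card_fin]

end Pairs

section Tournaments

/-- The alternating tournament on `ℕ`: `v` beats the smaller numbers of its own parity and the
larger numbers of the other parity. -/
def Beats (v u : ℕ) : Prop := (u < v ∧ u % 2 = v % 2) ∨ (v < u ∧ u % 2 ≠ v % 2)

instance (v : ℕ) : DecidablePred (Beats v) := fun u => by unfold Beats; infer_instance

lemma card_filter_beats (l v : ℕ) :
    #{u ∈ range l | Beats v u} =
      if l ≤ v then (l + (1 - v % 2)) / 2 else v / 2 + (l - v) / 2 := by
  induction l with
  | zero => simp; omega
  | succ l ih =>
    have hl : Beats v l ↔ (l < v ∧ l % 2 = v % 2) ∨ (v < l ∧ l % 2 ≠ v % 2) := Iff.rfl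
    rw [range_add_one, filter_insert]
    simp only [hl]
    split_ifs at ih ⊢ <;>
      first | (rw [card_insert_of_notMem (by simp), ih]; omega) | (rw [ih]; omega)

lemma exists_balanced_tournament {α : Type*} (L : Finset α) :
    ∃ B : α → Finset α, (∀ v, B v ⊆ L) ∧ (∀ u v, u ∈ B v → v ∉ B u) ∧
      (∀ u ∈ L, ∀ v ∈ L, u ≠ v → u ∈ B v ∨ v ∈ B u) ∧
      ∀ v ∈ L, (#L - 1) / 2 ≤ #(B v) ∧ #(B v) ≤ #L / 2 := by
  obtain ⟨rank, hrank⟩ := L.finite_toSet.exists_bijOn_of_encard_eq (t := (range #L : Set ℕ))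
    (by simp only [Set.encard_coe_eq_coe_finsetCard, card_range])
  refine ⟨fun v => {u ∈ L | Beats (rank v) (rank u)}, fun v => filter_subset _ L,
    fun u v h h' => ?_, fun u hu v hv huv => ?_, fun v hv => ?_⟩
  · have h := (mem_filter.1 h).2
    have h' := (mem_filter.1 h').2
    unfold Beats at h h'
    omega
  · have hne : rank u ≠ rank v := fun h => huv (hrank.injOn hu hv h)
    have hbeats : Beats (rank v) (rank u) ∨ Beats (rank u) (rank v) := by
      unfold Beats
      omega
    exact hbeats.imp (fun h => mem_filter.2 ⟨hu, h⟩) fun h => mem_filter.2 ⟨hv, h⟩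
  · have hlt : rank v < #L := mem_range.1 (hrank.mapsTo hv)
    have hcard : #{u ∈ L | Beats (rank v) (rank u)} = #{n ∈ range #L | Beats (rank v) n} := by
      refine card_nbij rank ?_ (hrank.injOn.mono (coe_subset.2 (filter_subset _ L))) ?_
      · exact fun u hu => mem_filter.2
          ⟨hrank.mapsTo (mem_filter.1 hu).1, (mem_filter.1 hu).2⟩
      · intro n hn
        obtain ⟨hn, hbeats⟩ := mem_filter.1 hn
        obtain ⟨u, hu, rfl⟩ := hrank.surjOn hn
        exact ⟨u, mem_coe.2 (mem_filter.2 ⟨hu, hbeats⟩), rfl⟩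
    rw [hcard, card_filter_beats, if_neg (by omega)]
    omega

/-- The pairs inside `L` that the assignment `w` of pairs to users gives to `j`. -/
def owned (L : Finset (Fin K)) (w : Pair K → Fin K) (j : Fin K) : Finset (Pair K) :=
  {I | I.1 ⊆ L ∧ w I = j}

lemma mem_owned {L : Finset (Fin K)} {w : Pair K → Fin K} {j : Fin K} {I : Pair K} :
    I ∈ owned L w j ↔ I.1 ⊆ L ∧ w I = j := mem_filter_univ _

section Owner

variable {L : Finset (Fin K)} {B : Fin K → Finset (Fin K)}

lemma Pair.exists_mem_of_tournament
    (htotal : ∀ u ∈ L, ∀ v ∈ L, u ≠ v → u ∈ B v ∨ v ∈ B u) {I : Pair K} (hI : I.1 ⊆ L) :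
    ∃ v, ∃ u ∈ B v, I.1 = {v, u} := by
  obtain ⟨a, b, hab, h⟩ := card_eq_two.1 I.2
  rw [h, insert_subset_iff, singleton_subset_iff] at hI
  rcases htotal a hI.1 b hI.2 hab with hB | hB
  · exact ⟨b, a, hB, by rw [h, pair_comm]⟩
  · exact ⟨a, b, hB, h⟩

lemma exists_owned_eq_star (hBL : ∀ v, B v ⊆ L) (hasymm : ∀ u v, u ∈ B v → v ∉ B u)
    (htotal : ∀ u ∈ L, ∀ v ∈ L, u ≠ v → u ∈ B v ∨ v ∈ B u) :
    ∃ w : Pair K → Fin K, (∀ I : Pair K, I.1 ⊆ L → w I ∈ I.1) ∧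
      ∀ j ∈ L, owned L w j = star j (B j) := by
  have hwinner : ∀ I : Pair K, ∃ v, I.1 ⊆ L → ∃ u ∈ B v, I.1 = {v, u} := by
    intro I
    by_cases hI : I.1 ⊆ L
    · exact (Pair.exists_mem_of_tournament htotal hI).imp fun _ h _ => h
    · obtain ⟨a, -⟩ := card_pos.1 (by rw [I.2]; norm_num : 0 < #I.1)
      exact ⟨a, fun h => absurd h hI⟩
  choose w hw using hwinner
  refine ⟨w, fun I hI => ?_, fun j hj => ?_⟩
  · obtain ⟨u, -, h⟩ := hw I hI
    simp [h]
  · ext I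
    rw [mem_owned, mem_star]
    constructor
    · rintro ⟨hI, rfl⟩
      exact hw I hI
    · rintro ⟨u, hu, h⟩
      have hI : I.1 ⊆ L := by simp [h, insert_subset_iff, hj, hBL j hu]
      refine ⟨hI, ?_⟩
      obtain ⟨u', hu', h'⟩ := hw I hI
      rw [h, ← coe_inj, coe_pair, coe_pair, Set.pair_eq_pair_iff] at h'
      rcases h' with ⟨hwj, -⟩ | ⟨rfl, huw⟩
      · exact hwj.symm
      · exact absurd hu' (huw ▸ hasymm u j hu)

lemma exists_balanced_owner (L : Finset (Fin K)) :
    ∃ w : Pair K → Fin K, (∀ I : Pair K, I.1 ⊆ L → w I ∈ I.1) ∧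
      ∀ j ∈ L, (#L - 1) / 2 ≤ #(owned L w j) ∧ #(owned L w j) ≤ #L / 2 := by
  obtain ⟨B, hBL, hasymm, htotal, hcard⟩ := exists_balanced_tournament L
  obtain ⟨w, hw, howned⟩ := exists_owned_eq_star hBL hasymm htotal
  refine ⟨w, hw, fun j hj => ?_⟩
  rw [howned j hj, card_star fun h => hasymm j j h h]
  exact hcard j hj

end Owner

end Tournaments

section Digraphs

section Skew

variable {G : Type*} [DecidableEq G]

/-- The difference between the numbers (`0` or `1`) of arcs `i → k` and `k → i` in the digraph with
out-neighbourhoods `T`; it is used to add up the asymmetries of several digraphs. -/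
def skew (T : G → Finset G) (i k : G) : ℤ :=
  (if k ∈ T i then 1 else 0) - if i ∈ T k then 1 else 0

variable {T : G → Finset G}

lemma skew_of_symmetric (hsymm : ∀ i k, k ∈ T i ↔ i ∈ T k) (i k : G) : skew T i k = 0 := by
  simp [skew, hsymm i k]

lemma skew_insert {σ : G → G} (hsymm : ∀ i k, k ∈ T i ↔ i ∈ T k) (hσ : ∀ i, σ i ∉ T i) (i k : G) :
    skew (fun i => insert (σ i) (T i)) i k = skew (fun i => {σ i}) i k := by
  by_cases hk : k ∈ T i
  · have hi := (hsymm i k).1 hk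
    simp [skew, hk, hi, (ne_of_mem_of_not_mem hk (hσ i)), (ne_of_mem_of_not_mem hi (hσ k))]
  · have hi := mt (hsymm i k).2 hk
    simp [skew, hk, hi]

lemma skew_singleton_add_neg [AddGroup G] (a i k : G) :
    skew (fun i => {i + -a}) i k = -skew (fun i => {i + a}) i k := by
  simp [skew, eq_add_neg_iff_add_eq, eq_comm]

lemma sum_skew {ι : Type*} (J : Finset ι) (T : ι → G → Finset G) (i k : G) :
    ∑ j ∈ J, skew (T j) i k = (#{j ∈ J | k ∈ T j i} : ℤ) - #{j ∈ J | i ∈ T j k} := by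
  simp only [skew, sum_sub_distrib, sum_boole]

end Skew

section AddGroup

variable {G : Type*}

lemma exists_neg_invariant_subset [InvolutiveNeg G] {X : Finset G}
    (hX : ∀ x ∈ X, -x ∈ X ∧ -x ≠ x) {c : ℕ} (hc : 2 * c ≤ #X) :
    ∃ S ⊆ X, (∀ x, -x ∈ S ↔ x ∈ S) ∧ #S = 2 * c := by
  classical
  induction c with
  | zero => exact ⟨∅, empty_subset X, by simp, rfl⟩
  | succ c ih =>
    obtain ⟨S, hSX, hneg, hS⟩ := ih (by omega)
    obtain ⟨x, hxX, hxS⟩ := exists_mem_notMem_of_card_lt_card (s := S) (t := X) (by omega)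
    have hx : x ∉ insert (-x) S := by simp [hxS, (hX x hxX).2.symm]
    refine ⟨insert x (insert (-x) S), ?_, fun y => ?_, ?_⟩
    · exact insert_subset hxX (insert_subset (hX x hxX).1 hSX)
    · simp only [mem_insert, hneg, neg_eq_iff_eq_neg, neg_neg]
      tauto
    · rw [card_insert_of_notMem hx, card_insert_of_notMem (by rwa [hneg]), hS]
      ring

lemma exists_symmetric_cayley_digraph [AddGroup G] {X : Finset G}
    (hX : ∀ x ∈ X, -x ∈ X ∧ -x ≠ x) {c : ℕ} (hc : 2 * c ≤ #X) :
    ∃ T : G → Finset G, (∀ i k, k ∈ T i → k - i ∈ X) ∧ (∀ i k, k ∈ T i ↔ i ∈ T k) ∧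
      ∀ i, #(T i) = 2 * c := by
  obtain ⟨S, hSX, hneg, hS⟩ := exists_neg_invariant_subset hX hc
  have hmem : ∀ i k, k ∈ S.map (addRightEmbedding i) ↔ k - i ∈ S := by
    simp [mem_map, ← eq_sub_iff_add_eq]
  refine ⟨fun i => S.map (addRightEmbedding i), fun i k h => hSX ((hmem i k).1 h),
    fun i k => ?_, fun i => by rw [card_map, hS]⟩
  rw [hmem, hmem, ← hneg, neg_sub]

end AddGroup

section Cyclic

variable {m δ : ℕ} [NeZero m]

lemma exists_symmetric_digraph_of_even (hδ : δ < m) (heven : Even δ) :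
    ∃ T : ZMod m → Finset (ZMod m), (∀ i, i ∉ T i) ∧ (∀ i k, k ∈ T i ↔ i ∈ T k) ∧
      ∀ i, #(T i) = δ := by
  set X : Finset (ZMod m) := {x | -x ≠ x}
  have hX : ∀ x ∈ X, -x ∈ X ∧ -x ≠ x := fun x hx => by
    simp only [X, mem_filter_univ, ne_eq, neg_neg] at hx ⊢
    exact ⟨fun h => hx h.symm, hx⟩
  have hcompl : Xᶜ ⊆ if Even m then {0, ((m / 2 : ℕ) : ZMod m)} else {0} := by
    intro x hx
    rcases (ZMod.neg_eq_self_iff x).1 (by simpa [X] using hx) with rfl | hx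
    · split_ifs <;> simp
    · have hhalf : ((m / 2 : ℕ) : ZMod m) = x := by
        rw [show m / 2 = x.val by omega, ZMod.natCast_zmod_val]
      have heven : Even m := ⟨x.val, by omega⟩
      simp [heven, hhalf]
  have hcard : 2 * (δ / 2) ≤ #X := by
    have := card_le_card hcompl
    have := card_le_two (a := (0 : ZMod m)) (b := ((m / 2 : ℕ) : ZMod m))
    rw [card_compl, ZMod.card] at *
    split_ifs at * <;> grind
  obtain ⟨T, hTX, hsymm, hT⟩ := exists_symmetric_cayley_digraph hX hcard
  exact ⟨T, fun i hi => by simpa [X] using hTX i i hi, hsymm,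
    fun i => by rw [hT, Nat.two_mul_div_two_of_even heven]⟩

lemma exists_symmetric_digraph (hδ : δ < m) (heven : Even m ∨ Even δ) :
    ∃ T : ZMod m → Finset (ZMod m), (∀ i, i ∉ T i) ∧ (∀ i k, k ∈ T i ↔ i ∈ T k) ∧
      ∀ i, #(T i) = δ := by
  rcases Nat.even_or_odd δ with heδ | hoδ
  · exact exists_symmetric_digraph_of_even hδ heδ
  have hm : Even m := heven.resolve_right (Nat.not_even_iff_odd.2 hoδ)
  -- The complement of a loopless regular digraph of even degree has odd degree.
  obtain ⟨T, hirrefl, hsymm, hT⟩ :=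
    exists_symmetric_digraph_of_even (δ := m - 1 - δ) (m := m) (by omega) (by grind)
  refine ⟨fun i => (insert i (T i))ᶜ, by simp, fun i k => ?_, fun i => ?_⟩
  · simp [hsymm i k, eq_comm]
  · rw [card_compl, ZMod.card, card_insert_of_notMem (hirrefl i), hT]
    omega

lemma exists_symmetric_digraph_of_odd (hδ : δ < m) (hm : Odd m) (hodd : Odd δ) :
    ∃ T : ZMod m → Finset (ZMod m), (∀ i, i ∉ T i ∧ i + 1 ∉ T i ∧ i - 1 ∉ T i) ∧
      (∀ i k, k ∈ T i ↔ i ∈ T k) ∧ ∀ i, #(T i) + 1 = δ := by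
  obtain ⟨c, rfl⟩ := hodd
  set X : Finset (ZMod m) := {0, 1, -1}ᶜ
  have hX : ∀ x ∈ X, -x ∈ X ∧ -x ≠ x := fun x hx => by
    have hx : ¬x = 0 ∧ ¬x = 1 ∧ ¬x = -1 := by simpa [X] using hx
    refine ⟨by simpa [X, neg_eq_iff_eq_neg (b := (1 : ZMod m))] using ⟨hx.1, hx.2.2, hx.2.1⟩,
      fun h => hx.1 ?_⟩
    exact ((ZMod.neg_eq_self_iff x).1 h).resolve_right fun h => by grind
  have hcard : 2 * c ≤ #X := by
    have := card_le_three (a := (0 : ZMod m)) (b := 1) (c := -1)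
    rw [card_compl, ZMod.card]
    grind
  obtain ⟨T, hTX, hsymm, hT⟩ := exists_symmetric_cayley_digraph hX hcard
  refine ⟨T, fun i => ⟨fun h => ?_, fun h => ?_, fun h => ?_⟩, hsymm, fun i => by rw [hT]⟩ <;>
    simpa [X] using hTX i _ h

lemma exists_near_perfect_matching (hm : Odd m) :
    ∃ ρ : ZMod m → ZMod m, (∀ i, ρ i = i + 1 ∨ ρ i = i - 1) ∧ ρ (-1) = 0 ∧
      ∀ i, i ≠ -1 → ρ i ≠ -1 ∧ ρ (ρ i) = i := by
  have hlast : Even (-1 : ZMod m).val := by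
    obtain ⟨n, rfl⟩ := hm
    rw [show (2 * n + 1) = (2 * n).succ from rfl, ZMod.val_neg_one]
    exact even_two_mul n
  have hsucc : ∀ i : ZMod m, i ≠ -1 → (i + 1).val = i.val + 1 := by
    intro i hi
    have hlt : i.val + 1 < m := by
      refine lt_of_le_of_ne i.val_lt fun h => hi (eq_neg_of_add_eq_zero_left ?_)
      simpa using congrArg (Nat.cast : ℕ → ZMod m) h
    simpa using ZMod.val_cast_of_lt hlt
  refine ⟨fun i => if Even i.val then i + 1 else i - 1, fun i => ?_, ?_, fun i hi => ?_⟩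
  · dsimp only
    split_ifs <;> simp
  · simp [hlast]
  · by_cases he : Even i.val
    · have ho : ¬Even (i + 1).val := by rwa [hsucc i hi, Nat.even_add_one, not_not]
      simp only [if_pos he, if_neg ho, add_sub_cancel_right, and_true]
      exact fun h => ho (h ▸ hlast)
    · have h0 : i - 1 ≠ -1 := fun h => he (by simp [show i = 0 by simpa using h])
      have he' : Even (i - 1).val := by
        have := hsucc (i - 1) h0
        rw [sub_add_cancel] at this
        rwa [this, Nat.even_add_one, not_not] at he
      simp [he, he', h0]

lemma exists_symmetric_subdigraph_of_odd (hδ : δ < m) (hm : Odd m) (hodd : Odd δ) :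
    ∃ T U : ZMod m → Finset (ZMod m), (∀ i, i ∉ T i) ∧ (∀ i, #(T i) = δ) ∧ (∀ i, U i ⊆ T i) ∧
      (∀ i k, k ∈ U i ↔ i ∈ U k) ∧ ∀ i k, k ∈ T i → k ∉ U i → i = -1 ∧ k = 0 := by
  obtain ⟨T, hT, hsymm, hcard⟩ := exists_symmetric_digraph_of_odd hδ hm hodd
  obtain ⟨ρ, hρ, hlast, hinv⟩ := exists_near_perfect_matching hm
  have hne : ∀ i, ρ i ∉ T i := fun i => by
    rcases hρ i with h | h <;> rw [h]
    exacts [(hT i).2.1, (hT i).2.2]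
  have : Fact (1 < m) := ⟨by have := hodd.pos; omega⟩
  refine ⟨fun i => insert (ρ i) (T i), fun i => if i = -1 then T i else insert (ρ i) (T i),
    fun i => ?_, fun i => ?_, fun i => ?_, fun i k => ?_, fun i k hk hk' => ?_⟩
  · have : i ≠ ρ i := by rcases hρ i with h | h <;> simp [h, eq_sub_iff_add_eq]
    simp [this, (hT i).1]
  · rw [card_insert_of_notMem (hne i), hcard]
  · dsimp only
    split_ifs <;> simp
  · have hpart : ∀ i k, i ≠ -1 → k = ρ i → k ≠ -1 ∧ i = ρ k := by
      rintro i _ hi rfl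
      exact ⟨(hinv i hi).1, (hinv i hi).2.symm⟩
    have := hpart i k
    have := hpart k i
    have := hsymm i k
    dsimp only
    split_ifs <;> grind
  · dsimp only at hk hk'
    split_ifs at hk' <;> grind

lemma exists_nearly_symmetric_digraph (hδ : δ < m) {s : ℤ} (hs : s = 0 ∨ s = 1 ∨ s = -1)
    (hodd : s ≠ 0 → Odd m ∧ Odd δ) :
    ∃ T U : ZMod m → Finset (ZMod m), (∀ i, i ∉ T i) ∧ (∀ i, #(T i) = δ) ∧ (∀ i, U i ⊆ T i) ∧
      (∀ i k, skew U i k = s * skew (fun i => {i + 1}) i k) ∧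
      ∀ i k, k ∈ T i → k ∉ U i → (Odd m ∧ Odd δ ∧ s = 0) ∧ i = -1 ∧ k = 0 := by
  rcases hs with rfl | hs
  · by_cases heven : Even m ∨ Even δ
    · obtain ⟨T, hT, hsymm, hcard⟩ := exists_symmetric_digraph hδ heven
      refine ⟨T, T, hT, hcard, fun i => Subset.rfl, fun i k => ?_, fun i k h h' => absurd h h'⟩
      rw [skew_of_symmetric hsymm, zero_mul]
    · obtain ⟨hm, ho⟩ : Odd m ∧ Odd δ := by grind
      obtain ⟨T, U, hT, hcard, hUT, hsymm, huniq⟩ := exists_symmetric_subdigraph_of_odd hδ hm ho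
      refine ⟨T, U, hT, hcard, hUT, fun i k => ?_, fun i k h h' => ⟨⟨hm, ho, rfl⟩, huniq i k h h'⟩⟩
      rw [skew_of_symmetric hsymm, zero_mul]
  · obtain ⟨hm, ho⟩ := hodd (by grind)
    obtain ⟨T, hT, hsymm, hcard⟩ := exists_symmetric_digraph_of_odd hδ hm ho
    have : Fact (1 < m) := ⟨by have := ho.pos; omega⟩
    obtain ⟨a, ha, haT, hskew⟩ : ∃ a : ZMod m, a ≠ 0 ∧ (∀ i, i + a ∉ T i) ∧
        ∀ i k, skew (fun i => {i + a}) i k = s * skew (fun i => {i + 1}) i k := by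
      rcases hs with rfl | rfl
      · exact ⟨1, one_ne_zero, fun i => (hT i).2.1, fun i k => by rw [one_mul]⟩
      · refine ⟨-1, neg_ne_zero.2 one_ne_zero, fun i => ?_, fun i k => ?_⟩
        · exact sub_eq_add_neg i 1 ▸ (hT i).2.2
        · rw [neg_one_mul, skew_singleton_add_neg]
    refine ⟨fun i => insert (i + a) (T i), fun i => insert (i + a) (T i), fun i => ?_, fun i => ?_,
      fun i => Subset.rfl, fun i k => ?_, fun i k h h' => absurd h h'⟩
    · simp [ha, (hT i).1]
    · rw [card_insert_of_notMem (haT i), hcard]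
    · rw [skew_insert hsymm haT, hskew]

end Cyclic

lemma exists_sum_signs_eq_zero {ι : Type*} (J : Finset ι) :
    ∃ s : ι → ℤ, (∀ j, s j = 0 ∨ s j = 1 ∨ s j = -1) ∧ (∀ j, s j ≠ 0 → j ∈ J) ∧
      ∑ j ∈ J, s j = 0 ∧ ∀ j ∈ J, ∀ j' ∈ J, s j = 0 → s j' = 0 → j = j' := by
  classical
  obtain ⟨A, hAJ, hA⟩ := exists_subset_card_eq (Nat.div_le_self #J 2)
  obtain ⟨B, hBJ, hB⟩ := exists_subset_card_eq (s := J \ A) (n := #J / 2)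
    (by rw [card_sdiff_of_subset hAJ]; omega)
  have hrest : #((J \ A) \ B) ≤ 1 := by
    rw [card_sdiff_of_subset hBJ, card_sdiff_of_subset hAJ]
    omega
  set s : ι → ℤ := fun j => (if j ∈ A then 1 else 0) - if j ∈ B then 1 else 0
  have hs0 : ∀ j ∈ J, s j = 0 → j ∈ (J \ A) \ B := by grind
  refine ⟨s, fun j => by grind, fun j => by grind, ?_,
    fun j hj j' hj' h h' => card_le_one.1 hrest j (hs0 j hj h) j' (hs0 j' hj' h')⟩
  have hBJ' : B ⊆ J := hBJ.trans sdiff_subset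
  simp [s, sum_sub_distrib, inter_eq_right.2 hAJ, inter_eq_right.2 hBJ', hA, hB]

/-- A family of loopless digraphs on `H`, given by their out-neighbourhoods `T j`, that is as
symmetric as the parities allow: the digraph `j` has out-degree `δ j` everywhere, and after deleting
at most one arc (the subgraphs `U j`) as many arcs lead from `i` to `k` as from `k` to `i`. -/
structure IsNearlySymmetric {ι α : Type*} [DecidableEq α] (J : Finset ι) (H : Finset α)
    (δ : ι → ℕ) (T U : ι → α → Finset α) : Prop where
  subset_erase : ∀ j ∈ J, ∀ i ∈ H, T j i ⊆ H.erase i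
  card_eq : ∀ j ∈ J, ∀ i ∈ H, #(T j i) = δ j
  subset : ∀ j ∈ J, ∀ i ∈ H, U j i ⊆ T j i
  balanced : ∀ i ∈ H, ∀ k ∈ H, #{j ∈ J | k ∈ U j i} = #{j ∈ J | i ∈ U j k}
  deleted_unique : ∀ j ∈ J, ∀ j' ∈ J, ∀ i ∈ H, ∀ i' ∈ H, ∀ k ∈ T j i \ U j i,
    ∀ k' ∈ T j' i' \ U j' i', j = j' ∧ i = i' ∧ k = k'

section NearlySymmetric

variable {ι α β : Type*} [DecidableEq α] [DecidableEq β] {J : Finset ι} {δ : ι → ℕ}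

lemma IsNearlySymmetric.comap [Fintype β] {T U : ι → β → Finset β} {H : Finset α} {f : α → β}
    (h : IsNearlySymmetric J univ δ T U) (hf : Set.BijOn f H (univ : Finset β)) :
    IsNearlySymmetric J H δ (fun j i => {k ∈ H | f k ∈ T j (f i)})
      (fun j i => {k ∈ H | f k ∈ U j (f i)}) where
  subset_erase j hj i hi k hk := by
    obtain ⟨hkH, hk⟩ := mem_filter.1 hk
    refine mem_erase.2 ⟨?_, hkH⟩
    rintro rfl
    exact notMem_erase _ _ (h.subset_erase j hj _ (mem_univ _) hk)
  card_eq j hj i _ := by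
    rw [← h.card_eq j hj (f i) (mem_univ _)]
    refine card_nbij f (fun k hk => (mem_filter.1 hk).2)
      (hf.injOn.mono (coe_subset.2 (filter_subset _ H))) fun b hb => ?_
    obtain ⟨k, hk, rfl⟩ := hf.surjOn (mem_coe.2 (mem_univ b))
    exact ⟨k, mem_coe.2 (mem_filter.2 ⟨hk, hb⟩), rfl⟩
  subset j hj i _ := monotone_filter_right H fun k _ hk => h.subset j hj (f i) (mem_univ _) hk
  balanced i hi k hk := by simpa [hi, hk] using h.balanced (f i) (mem_univ _) (f k) (mem_univ _)
  deleted_unique j hj j' hj' i hi i' hi' k hk k' hk' := by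
    have hmem : ∀ {j i k}, k ∈ {k ∈ H | f k ∈ T j (f i)} \ {k ∈ H | f k ∈ U j (f i)} →
        k ∈ H ∧ f k ∈ T j (f i) \ U j (f i) := by grind
    obtain ⟨hkH, hk⟩ := hmem hk
    obtain ⟨hkH', hk'⟩ := hmem hk'
    obtain ⟨rfl, hii, hkk⟩ :=
      h.deleted_unique j hj j' hj' _ (mem_univ _) _ (mem_univ _) _ hk _ hk'
    exact ⟨rfl, hf.injOn hi hi' hii, hf.injOn hkH hkH' hkk⟩

lemma exists_isNearlySymmetric_zmod {m : ℕ} [NeZero m] (hδ : ∀ j ∈ J, δ j < m) :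
    ∃ T U : ι → ZMod m → Finset (ZMod m), IsNearlySymmetric J univ δ T U := by
  obtain ⟨s, hs, hsJ, hsum, hs0⟩ := exists_sum_signs_eq_zero {j ∈ J | Odd m ∧ Odd (δ j)}
  have hsum : ∑ j ∈ J, s j = 0 := by
    rwa [sum_filter_of_ne fun j _ hj => (mem_filter.1 (hsJ j hj)).2] at hsum
  choose! T U hT hcard hUT hskew hdel using fun j (hj : j ∈ J) =>
    exists_nearly_symmetric_digraph (hδ j hj) (hs j) fun hj => (mem_filter.1 (hsJ j hj)).2
  refine ⟨T, U, ?_, fun j hj i _ => hcard j hj i, fun j hj i _ => hUT j hj i,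
    fun i _ k _ => ?_, fun j hj j' hj' i _ i' _ k hk k' hk' => ?_⟩
  · exact fun j hj i _ k hk => mem_erase.2 ⟨ne_of_mem_of_not_mem hk (hT j hj i), mem_univ k⟩
  · have : ∑ j ∈ J, skew (U j) i k = 0 := by
      rw [sum_congr rfl fun j hj => hskew j hj i k, ← sum_mul, hsum, zero_mul]
    rw [sum_skew] at this
    omega
  · rw [mem_sdiff] at hk hk'
    obtain ⟨⟨hm, hδj, hsj⟩, rfl, rfl⟩ := hdel j hj i k hk.1 hk.2
    obtain ⟨⟨-, hδj', hsj'⟩, rfl, rfl⟩ := hdel j' hj' i' k' hk'.1 hk'.2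
    exact ⟨hs0 j (mem_filter.2 ⟨hj, hm, hδj⟩) j' (mem_filter.2 ⟨hj', hm, hδj'⟩) hsj hsj', rfl, rfl⟩

lemma exists_isNearlySymmetric {H : Finset α} (hδ : ∀ j ∈ J, δ j < #H) :
    ∃ T U : ι → α → Finset α, IsNearlySymmetric J H δ T U := by
  rcases H.eq_empty_or_nonempty with rfl | hH
  · exact ⟨fun _ _ => ∅, fun _ _ => ∅, by constructor <;> simp⟩
  have : NeZero #H := ⟨hH.card_pos.ne'⟩
  obtain ⟨f, hf⟩ := H.finite_toSet.exists_bijOn_of_encard_eq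
    (t := ((univ : Finset (ZMod #H)) : Set (ZMod #H)))
    (by simp only [Set.encard_coe_eq_coe_finsetCard, card_univ, ZMod.card])
  obtain ⟨T, U, h⟩ := exists_isNearlySymmetric_zmod hδ
  exact ⟨_, _, h.comap hf⟩

end NearlySymmetric

end Digraphs

section Placement

variable {q Nh : ℕ} {P : Placement K N} {n : Fin N}

lemma choose_two_of_eq_two_mul_add_one (hq : K = 2 * q + 1) : K.choose 2 = K * q := by
  rw [Nat.choose_two_right, hq, Nat.add_sub_cancel, mul_left_comm,
    Nat.mul_div_cancel_left _ two_pos]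

lemma exists_eq_two_mul_add_one (hK : 0 < K) (hdvd : K ∣ K.choose 2) : ∃ q, K = 2 * q + 1 := by
  obtain ⟨q, hq⟩ := hdvd
  refine ⟨q, ?_⟩
  have hmul : K * (K - 1) = K * (2 * q) := by
    rw [mul_left_comm, ← hq, Nat.choose_two_right,
      Nat.mul_div_cancel' (Nat.even_mul_pred_self K).two_dvd]
  have := Nat.eq_of_mul_eq_mul_left hK hmul
  omega

lemma exists_even_owner (hq : K = 2 * q + 1) :
    ∃ w : Pair K → Fin K, (∀ I, w I ∈ I.1) ∧ ∀ u, #{I | w I = u} = q := by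
  obtain ⟨w, hmem, hcard⟩ := exists_balanced_owner (univ : Finset (Fin K))
  refine ⟨w, fun I => hmem I (subset_univ _), fun u => ?_⟩
  have := hcard u (mem_univ u)
  simp only [owned, subset_univ, true_and, card_univ, Fintype.card_fin] at this
  omega

lemma evenlySplit_of_eq_singleton {w : Pair K → Fin K} (hq : K = 2 * q + 1)
    (hP : ∀ I, P n I = {w I}) (hw : ∀ u, #{I | w I = u} = q) : EvenlySplit P n := by
  refine ⟨fun I => by rw [hP, card_singleton], fun u => ?_⟩
  simp only [hP, mem_singleton, eq_comm (a := u), hw, choose_two_of_eq_two_mul_add_one hq]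

lemma EvenlySplit.card_eq (h : EvenlySplit P n) (hq : K = 2 * q + 1) (u : Fin K) :
    #{I | u ∈ P n I} = q :=
  Nat.eq_of_mul_eq_mul_left u.pos ((h.2 u).trans (choose_two_of_eq_two_mul_add_one hq))

lemma EvenlySplit.eq_of_mem (h : EvenlySplit P n) {I : Pair K} {u v : Fin K} (hu : u ∈ P n I)
    (hv : v ∈ P n I) : u = v :=
  card_le_one.1 (h.1 I).le u hu v hv

lemma EvenlySplit.exists_mem (h : EvenlySplit P n) (I : Pair K) : ∃ u, u ∈ P n I :=
  card_pos.1 (by rw [h.1 I]; exact one_pos)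

lemma exists_isCL21Placement (hq : K = 2 * q + 1) (Nh : ℕ) :
    ∃ P : Placement K N, IsCL21Placement Nh P := by
  obtain ⟨w, -, hw⟩ := exists_even_owner hq
  refine ⟨fun n I => if n.val < Nh then I.1 else {w I}, fun n hn I => if_pos hn, fun n hn => ?_⟩
  exact evenlySplit_of_eq_singleton hq (fun I => if_neg hn.not_gt) hw

lemma card_file_eq {F b : ℕ} (split : Fin F ≃ Pair K × Fin b) : F = K.choose 2 * b := by
  rw [← card_univ_pair, card_univ]
  simpa only [Fintype.card_prod, Fintype.card_fin] using Fintype.card_congr split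

lemma card_filter_split {F b : ℕ} (split : Fin F ≃ Pair K × Fin b) (p : Pair K → Prop)
    [DecidablePred p] : #{x : Fin F | p (split x).1} = #{I | p I} * b := by
  rw [card_equiv (t := ({I | p I} : Finset (Pair K)) ×ˢ (univ : Finset (Fin b))) split (by simp),
    card_product, card_univ, Fintype.card_fin]

lemma IsCL21Placement.card_eq (hP : IsCL21Placement Nh P) (hq : K = 2 * q + 1) (u : Fin K)
    (n : Fin N) : #{I | u ∈ P n I} = if n.val < Nh then 2 * q else q := by
  split_ifs with h
  · simp only [hP.1 n h, card_pairs_mem, hq, Nat.add_sub_cancel]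
  · exact (hP.2 n (not_lt.1 h)).card_eq hq u

lemma IsCL21Placement.card_cachedBits (hP : IsCL21Placement Nh P) (hq : K = 2 * q + 1)
    (hN : Nh ≤ N) {F b : ℕ} (split : Fin F ≃ Pair K × Fin b) (u : Fin K) :
    #(cachedBits split P u) = (Nh + N) * q * b := by
  have hfile : ∀ n : Fin N, #{x : Fin F | u ∈ P n (split x).1} =
      (if n.val < Nh then q * b else 0) + q * b := fun n => by
    rw [card_filter_split split (fun I => u ∈ P n I), hP.card_eq hq]
    split_ifs <;> ring
  calc #(cachedBits split P u) = ∑ n : Fin N, #{x : Fin F | u ∈ P n (split x).1} := by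
        rw [cachedBits, card_filter, Fintype.sum_prod_type]
        simp only [card_filter]
    _ = Nh * (q * b) + N * (q * b) := by
        simp only [hfile, sum_add_distrib, ← sum_filter, sum_const, Fin.card_filter_val_lt,
          min_eq_right hN, card_univ, Fintype.card_fin, smul_eq_mul]
    _ = (Nh + N) * q * b := by ring

lemma IsCL21Placement.card_cachedBits_eq_cacheSize_mul (hP : IsCL21Placement Nh P)
    (hq : K = 2 * q + 1) (hN : Nh ≤ N) {F b : ℕ} (split : Fin F ≃ Pair K × Fin b) (u : Fin K) :
    (#(cachedBits split P u) : ℚ) = cacheSize K Nh N 2 * F := by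
  have hK : (K : ℚ) ≠ 0 := Nat.cast_ne_zero.2 u.pos.ne'
  rw [hP.card_cachedBits hq hN, card_file_eq split, choose_two_of_eq_two_mul_add_one hq, cacheSize]
  push_cast
  field_simp
  ring

lemma lowUsers_eq_compl (Nh : ℕ) (d : Fin K → Fin N) : lowUsers Nh d = (highUsers Nh d)ᶜ := by
  ext u
  simp [lowUsers, highUsers]

lemma IsCL21Placement.card_missing (hP : IsCL21Placement Nh P) (hq : K = 2 * q + 1)
    (d : Fin K → Fin N) (u : Fin K) :
    #(missing P d u) + ((if u ∈ highUsers Nh d then q else 0) + q) = K * q := by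
  have hsplit := card_filter_add_card_filter_not (s := (univ : Finset (Pair K)))
    (fun I => u ∈ P (d u) I)
  rw [card_univ_pair, choose_two_of_eq_two_mul_add_one hq, hP.card_eq hq] at hsplit
  have hhigh : u ∈ highUsers Nh d ↔ (d u).val < Nh := mem_filter_univ u
  simp only [← hsplit, missing, hhigh]
  split_ifs <;> ring

lemma IsCL21Placement.sum_card_missing (hP : IsCL21Placement Nh P) (hq : K = 2 * q + 1)
    (d : Fin K → Fin N) :
    ((∑ u : Fin K, #(missing P d u) : ℕ) : ℚ) =
      totalMissing K #(highUsers Nh d) #(lowUsers Nh d) := by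
  have hsum : ∑ u : Fin K, #(missing P d u) + (#(highUsers Nh d) * q + K * q) = K * (K * q) := by
    have := sum_congr rfl fun u (_ : u ∈ univ) => hP.card_missing hq d u
    simpa [sum_add_distrib, ← sum_filter] using this
  have hlow : (#(lowUsers Nh d) : ℚ) = K - #(highUsers Nh d) := by
    rw [lowUsers_eq_compl, card_compl, Fintype.card_fin, Nat.cast_sub (card_finset_fin_le _)]
  have hq' : (q : ℚ) = (K - 1) / 2 := by
    rw [hq]
    push_cast
    ring
  have hsum : ((∑ u : Fin K, #(missing P d u) : ℕ) : ℚ) + (#(highUsers Nh d) * q + K * q) =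
      K * (K * q) := by exact_mod_cast hsum
  rw [totalMissing, eq_sub_of_add_eq hsum, hlow, hq']
  ring

end Placement

lemma mem_avail {P : Placement K N} {d : Fin K → Fin N} {r c : Fin K} {I : Pair K} :
    I ∈ avail P d r c ↔ r ∉ P (d r) I ∧ c ∈ P (d r) I := by
  simp [avail, missing]

/-- The set of all `(u, I)` such that user `u` has to receive the sub-file `I` of its file. -/
def requests (P : Placement K N) (d : Fin K → Fin N) : Finset (Fin K × Pair K) :=
  {x | x.1 ∉ P (d x.1) x.2}

lemma mem_requests {P : Placement K N} {d : Fin K → Fin N} {x : Fin K × Pair K} :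
    x ∈ requests P d ↔ x.1 ∉ P (d x.1) x.2 := mem_filter_univ _

lemma card_requests (P : Placement K N) (d : Fin K → Fin N) :
    #(requests P d) = ∑ u, #(missing P d u) := by
  rw [requests, card_filter, Fintype.sum_prod_type]
  simp only [missing, card_filter]

/-- The messages in `D` partition the set `X` of requests, and of each request listed in a message
the sub-file is cached by all other users listed in that message. -/
structure Delivers (P : Placement K N) (d : Fin K → Fin N) (D : Finset (Message K))
    (X : Finset (Fin K × Pair K)) : Prop where
  pairwiseDisjoint : (D : Set (Message K)).PairwiseDisjoint id
  biUnion_eq : D.biUnion id = X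
  nonempty : ∀ m ∈ D, m.Nonempty
  cached : ∀ m ∈ D, ∀ x ∈ m, ∀ y ∈ m, x ≠ y → x.1 ∈ P (d y.1) y.2

namespace Delivers

variable {P P' : Placement K N} {d : Fin K → Fin N} {D D' : Finset (Message K)}
  {X X' : Finset (Fin K × Pair K)}

lemma exists_mem_iff (h : Delivers P d D X) {x : Fin K × Pair K} :
    (∃ m ∈ D, x ∈ m) ↔ x ∈ X := by
  simp [← h.biUnion_eq]

lemma subset (h : Delivers P d D X) {m : Message K} (hm : m ∈ D) : m ⊆ X :=
  fun _ hx => h.exists_mem_iff.1 ⟨m, hm, hx⟩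

lemma mono (h : Delivers P d D X) (hP : ∀ n I, P n I ⊆ P' n I) : Delivers P' d D X where
  pairwiseDisjoint := h.pairwiseDisjoint
  biUnion_eq := h.biUnion_eq
  nonempty := h.nonempty
  cached m hm x hx y hy hxy := hP _ _ (h.cached m hm x hx y hy hxy)

lemma disjoint (h : Delivers P d D X) (h' : Delivers P d D' X') (hX : Disjoint X X') :
    Disjoint D D' := by
  refine disjoint_left.2 fun m hm hm' => ?_
  obtain ⟨x, hx⟩ := h.nonempty m hm
  exact disjoint_left.1 hX (h.subset hm hx) (h'.subset hm' hx)

lemma union (h : Delivers P d D X) (h' : Delivers P d D' X') (hX : Disjoint X X') :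
    Delivers P d (D ∪ D') (X ∪ X') where
  pairwiseDisjoint := by
    rw [coe_union, Set.pairwiseDisjoint_union]
    exact ⟨h.pairwiseDisjoint, h'.pairwiseDisjoint, fun m hm m' hm' _ =>
      disjoint_of_subset_left (h.subset hm) (disjoint_of_subset_right (h'.subset hm') hX)⟩
  biUnion_eq := by rw [union_biUnion, h.biUnion_eq, h'.biUnion_eq]
  nonempty m hm := (mem_union.1 hm).elim (h.nonempty m) (h'.nonempty m)
  cached m hm := (mem_union.1 hm).elim (h.cached m) (h'.cached m)

lemma card_eq_mul (h : Delivers P d D X) {c : ℕ} (hc : ∀ m ∈ D, #m = c) : #X = #D * c := by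
  rw [← h.biUnion_eq, card_biUnion h.pairwiseDisjoint]
  exact sum_const_nat hc

lemma decodable (h : Delivers P d D X) (hX : requests P d ⊆ X) {F b : ℕ}
    (split : Fin F ≃ Pair K × Fin b) : Decodable split P d D := by
  intro u
  let observed : Library N F → (cachedBits split P u → ZMod 2) × (D → Fin b → ZMod 2) :=
    fun W => (fun x => W x.1.1 x.1.2, fun m => transmit split d W m.1)
  suffices hfac : (fun W : Library N F => W (d u)).FactorsThrough observed from
    ⟨fun c t => Function.extend observed (fun W => W (d u)) (fun _ _ => 0) (c, t),
      fun W => hfac.extend_apply (fun _ _ => 0) W⟩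
  intro W W' hobs
  have hcache : ∀ n y, u ∈ P n (split y).1 → W n y = W' n y := fun n y hy =>
    congrFun (congrArg Prod.fst hobs) ⟨(n, y), (mem_filter_univ _).2 hy⟩
  funext y
  by_cases hy : u ∈ P (d u) (split y).1
  · exact hcache _ _ hy
  obtain ⟨m, hm, hmem⟩ := h.exists_mem_iff.2 (hX (mem_requests (x := (u, (split y).1)).2 hy))
  have hbit : ∑ x ∈ m, W (d x.1) (split.symm (x.2, (split y).2)) =
      ∑ x ∈ m, W' (d x.1) (split.symm (x.2, (split y).2)) :=
    congrFun (congrFun (congrArg Prod.snd hobs) ⟨m, hm⟩) (split y).2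
  have hrest : ∀ x ∈ m.erase (u, (split y).1),
      W (d x.1) (split.symm (x.2, (split y).2)) = W' (d x.1) (split.symm (x.2, (split y).2)) := by
    intro x hx
    obtain ⟨hne, hx⟩ := mem_erase.1 hx
    exact hcache _ _ (by simpa using h.cached m hm _ hmem x hx hne.symm)
  rw [← add_sum_erase m _ hmem, ← add_sum_erase m _ hmem, sum_congr rfl hrest] at hbit
  simpa using add_right_cancel hbit

end Delivers

lemma delivers_image_singleton (P : Placement K N) (d : Fin K → Fin N)
    (X : Finset (Fin K × Pair K)) : Delivers P d (X.image singleton) X where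
  pairwiseDisjoint := by
    simp only [Set.PairwiseDisjoint, Set.Pairwise, mem_coe, mem_image]
    rintro _ ⟨x, -, rfl⟩ _ ⟨y, -, rfl⟩ hxy
    exact disjoint_singleton.2 fun h => hxy (h ▸ rfl)
  biUnion_eq := by rw [image_biUnion]; exact biUnion_singleton_eq_self
  nonempty := by
    simp only [mem_image]
    rintro _ ⟨x, -, rfl⟩
    exact singleton_nonempty x
  cached := by
    simp only [mem_image]
    rintro _ ⟨z, -, rfl⟩ x hx y hy hxy
    rw [mem_singleton] at hx hy
    exact absurd (hx.trans hy.symm) hxy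

section Pairing

/-- `A u v` is a set of sub-files that `u` is going to receive from messages built together with
`v`, in exchange for the equally many sub-files in `A v u`. -/
structure IsExchangePlan (P : Placement K N) (d : Fin K → Fin N)
    (A : Fin K → Fin K → Finset (Pair K)) : Prop where
  subset_avail : ∀ u v, A u v ⊆ avail P d u v
  eq_of_mem : ∀ u v v' I, I ∈ A u v → I ∈ A u v' → v = v'
  card_comm : ∀ u v, #(A u v) = #(A v u)

/-- `e u v` matches the sub-files in `A u v` with those in `A v u`. -/
def IsMatching (A : Fin K → Fin K → Finset (Pair K)) (e : Fin K → Fin K → Pair K → Pair K) : Prop :=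
  ∀ u v, Set.BijOn (e u v) (A u v) (A v u)

/-- The messages that combine, for each `(u, v) ∈ E`, the sub-files in `A u v` for `u` with those in
`A v u` for `v`, as matched by `e u v`. -/
def pairing (E : Finset (Fin K × Fin K)) (A : Fin K → Fin K → Finset (Pair K))
    (e : Fin K → Fin K → Pair K → Pair K) : Finset (Message K) :=
  E.biUnion fun x => (A x.1 x.2).image fun I => {(x.1, I), (x.2, e x.1 x.2 I)}

/-- The requests that are served by exchanging the sub-files in the sets `A u v` along `E`. -/
def served (E : Finset (Fin K × Fin K)) (A : Fin K → Fin K → Finset (Pair K)) :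
    Finset (Fin K × Pair K) :=
  {x | ∃ v, ((x.1, v) ∈ E ∨ (v, x.1) ∈ E) ∧ x.2 ∈ A x.1 v}

variable {P : Placement K N} {d : Fin K → Fin N} {E E' : Finset (Fin K × Fin K)}
  {A : Fin K → Fin K → Finset (Pair K)} {e : Fin K → Fin K → Pair K → Pair K}

lemma IsExchangePlan.exists_isMatching (h : IsExchangePlan P d A) : ∃ e, IsMatching A e := by
  have hbij : ∀ u v, ∃ f : Pair K → Pair K, Set.BijOn f (A u v) (A v u) := by
    intro u v
    rcases isEmpty_or_nonempty (Pair K)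
    · exact ⟨id, by simp [eq_empty_of_isEmpty]⟩
    · exact (A u v).finite_toSet.exists_bijOn_of_encard_eq
        (by simp only [Set.encard_coe_eq_coe_finsetCard, h.card_comm u v])
  choose e he using hbij
  exact ⟨e, he⟩

lemma mem_pairing {m : Message K} :
    m ∈ pairing E A e ↔ ∃ u v, (u, v) ∈ E ∧ ∃ I ∈ A u v, m = {(u, I), (v, e u v I)} := by
  simp only [pairing, mem_biUnion, mem_image, Prod.exists, eq_comm]

lemma pairing_union : pairing (E ∪ E') A e = pairing E A e ∪ pairing E' A e :=
  union_biUnion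

lemma mem_served {x : Fin K × Pair K} :
    x ∈ served E A ↔ ∃ v, ((x.1, v) ∈ E ∨ (v, x.1) ∈ E) ∧ x.2 ∈ A x.1 v := mem_filter_univ _

lemma biUnion_pairing (he : IsMatching A e) : (pairing E A e).biUnion id = served E A := by
  ext ⟨u, I⟩
  simp only [mem_biUnion, id_eq, mem_pairing, mem_served]
  constructor
  · rintro ⟨_, ⟨v, v', hE, I', hI', rfl⟩, hx⟩
    rcases mem_insert.1 hx with hx | hx
    · obtain ⟨rfl, rfl⟩ := Prod.mk.inj hx
      exact ⟨v', Or.inl hE, hI'⟩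
    · obtain ⟨rfl, rfl⟩ := Prod.mk.inj (mem_singleton.1 hx)
      exact ⟨v, Or.inr hE, (he _ _).mapsTo hI'⟩
  · rintro ⟨v, hE | hE, hI⟩
    · exact ⟨_, ⟨u, v, hE, I, hI, rfl⟩, by simp⟩
    · obtain ⟨I', hI', rfl⟩ := (he v u).surjOn hI
      exact ⟨_, ⟨v, u, hE, I', hI', rfl⟩, by simp⟩

lemma exists_of_mem_pairing (he : IsMatching A e) {m : Message K} (hm : m ∈ pairing E A e)
    {u : Fin K} {I : Pair K} (hu : (u, I) ∈ m) :
    ∃ v, I ∈ A u v ∧ (((u, v) ∈ E ∧ m = {(u, I), (v, e u v I)}) ∨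
      ((v, u) ∈ E ∧ ∃ I' ∈ A v u, e v u I' = I ∧ m = {(v, I'), (u, I)})) := by
  obtain ⟨u', v', hE, I', hI', rfl⟩ := mem_pairing.1 hm
  rcases mem_insert.1 hu with hx | hx
  · obtain ⟨rfl, rfl⟩ := Prod.mk.inj hx
    exact ⟨v', hI', Or.inl ⟨hE, rfl⟩⟩
  · obtain ⟨rfl, rfl⟩ := Prod.mk.inj (mem_singleton.1 hx)
    exact ⟨u', (he _ _).mapsTo hI', Or.inr ⟨hE, I', hI', rfl, rfl⟩⟩

lemma IsExchangePlan.delivers_pairing (h : IsExchangePlan P d A) (he : IsMatching A e)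
    (hE : ∀ u v, (u, v) ∈ E → (v, u) ∉ E) : Delivers P d (pairing E A e) (served E A) where
  biUnion_eq := biUnion_pairing he
  pairwiseDisjoint m hm m' hm' hne := by
    refine disjoint_left.2 fun ⟨u, I⟩ hu hu' => hne ?_
    obtain ⟨v, hv, hm⟩ := exists_of_mem_pairing he hm hu
    obtain ⟨v', hv', hm'⟩ := exists_of_mem_pairing he hm' hu'
    obtain rfl := h.eq_of_mem u v v' I hv hv'
    rcases hm with ⟨huv, rfl⟩ | ⟨hvu, I', hI', rfl, rfl⟩ <;>
      rcases hm' with ⟨huv', rfl⟩ | ⟨hvu', I'', hI'', hII, rfl⟩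
    · rfl
    · exact absurd huv (hE _ _ hvu')
    · exact absurd huv' (hE _ _ hvu)
    · rw [(he v u).injOn hI'' hI' hII]
  nonempty m hm := by
    obtain ⟨u, v, -, I, -, rfl⟩ := mem_pairing.1 hm
    exact insert_nonempty _ _
  cached m hm := by
    obtain ⟨u, v, -, I, hI, rfl⟩ := mem_pairing.1 hm
    have hv := (mem_avail.1 (h.subset_avail u v hI)).2
    have hu := (mem_avail.1 (h.subset_avail v u ((he u v).mapsTo hI))).2
    simp [hu, hv]

lemma card_of_mem_pairing (hE : ∀ u v, (u, v) ∈ E → (v, u) ∉ E) {m : Message K}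
    (hm : m ∈ pairing E A e) : #m = 2 := by
  obtain ⟨u, v, huv, I, -, rfl⟩ := mem_pairing.1 hm
  refine card_pair fun h => ?_
  obtain rfl : u = v := congrArg Prod.fst h
  exact hE _ _ huv huv

/-- The pairs of elements of `S` in ascending order, one for each two-element subset of `S`. -/
def ascendingPairs (S : Finset (Fin K)) : Finset (Fin K × Fin K) :=
  {x ∈ S ×ˢ S | x.1 < x.2}

lemma mem_ascendingPairs {S : Finset (Fin K)} {u v : Fin K} :
    (u, v) ∈ ascendingPairs S ↔ (u ∈ S ∧ v ∈ S) ∧ u < v := by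
  rw [ascendingPairs, mem_filter, mem_product]

lemma ascendingPairs_asymm {S : Finset (Fin K)} {u v : Fin K} (h : (u, v) ∈ ascendingPairs S) :
    (v, u) ∉ ascendingPairs S :=
  fun h' => lt_asymm (mem_ascendingPairs.1 h).2 (mem_ascendingPairs.1 h').2

lemma isLevelOneDelivery_pairing {S : Finset (Fin K)} (he : IsMatching A e)
    (hA : ∀ u ∈ S, A u = avail P d u) :
    IsLevelOneDelivery P d S (pairing (ascendingPairs S) A e) := by
  refine ⟨e, fun j hj k hk _ => hA j hj ▸ hA k hk ▸ he j k, fun m => ?_⟩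
  simp only [mem_pairing, mem_ascendingPairs]
  constructor
  · rintro ⟨j, k, ⟨⟨hj, hk⟩, hjk⟩, hI⟩
    exact ⟨j, hj, k, hk, hjk, hA j hj ▸ hI⟩
  · rintro ⟨j, hj, k, hk, hjk, hI⟩
    exact ⟨j, k, ⟨⟨hj, hk⟩, hjk⟩, (hA j hj).symm ▸ hI⟩

end Pairing

section Fallback

variable {q Nh : ℕ} {P : Placement K N} {d : Fin K → Fin N}

lemma EvenlySplit.card_avail {r c : Fin K} (h : EvenlySplit P (d r)) (hq : K = 2 * q + 1)
    (hrc : r ≠ c) : #(avail P d r c) = q := by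
  rw [← h.card_eq hq c]
  congr 1
  ext I
  rw [mem_avail, mem_filter_univ, and_iff_right_iff_imp]
  exact fun hc hr => hrc (h.eq_of_mem hr hc)

lemma EvenlySplit.card_missing {u : Fin K} (h : EvenlySplit P (d u)) (hq : K = 2 * q + 1) :
    #(missing P d u) = 2 * q * q := by
  have hsplit := card_filter_add_card_filter_not (s := (univ : Finset (Pair K)))
    (fun I => u ∈ P (d u) I)
  rw [card_univ_pair, choose_two_of_eq_two_mul_add_one hq, h.card_eq hq] at hsplit
  rw [missing]
  have : K * q = 2 * q * q + q := by rw [hq]; ring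
  omega

lemma isExchangePlan_avail (h : ∀ u, EvenlySplit P (d u)) (hq : K = 2 * q + 1) :
    IsExchangePlan P d (avail P d) where
  subset_avail _ _ := Subset.rfl
  eq_of_mem u v v' I hv hv' := (h u).eq_of_mem (mem_avail.1 hv).2 (mem_avail.1 hv').2
  card_comm u v := by
    rcases eq_or_ne u v with rfl | huv
    · rfl
    · rw [(h u).card_avail hq huv, (h v).card_avail hq huv.symm]

lemma exists_isLevelOneDelivery_univ (h : ∀ u, EvenlySplit P (d u)) (hq : K = 2 * q + 1) :
    ∃ D, IsLevelOneDelivery P d univ D ∧ Delivers P d D (requests P d) ∧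
      #D = K.choose 2 * q := by
  have hplan := isExchangePlan_avail h hq
  obtain ⟨e, he⟩ := hplan.exists_isMatching
  have hasymm : ∀ u v : Fin K, (u, v) ∈ ascendingPairs univ → (v, u) ∉ ascendingPairs univ :=
    fun _ _ => ascendingPairs_asymm
  have hserved : served (ascendingPairs univ) (avail P d) = requests P d := by
    ext ⟨u, I⟩
    simp only [mem_served, mem_requests, mem_ascendingPairs, mem_univ, and_self, true_and,
      mem_avail]
    refine ⟨fun ⟨_, _, hu, _⟩ => hu, fun hu => ?_⟩
    obtain ⟨v, hv⟩ := (h u).exists_mem I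
    exact ⟨v, lt_or_gt_of_ne fun huv => hu (huv ▸ hv), hu, hv⟩
  have hD := hserved ▸ hplan.delivers_pairing he hasymm
  refine ⟨_, isLevelOneDelivery_pairing he fun _ _ => rfl, hD, ?_⟩
  have hcard := hD.card_eq_mul fun m => card_of_mem_pairing hasymm
  simp only [card_requests, fun u => (h u).card_missing hq, sum_const, card_univ,
    Fintype.card_fin, smul_eq_mul] at hcard
  rw [choose_two_of_eq_two_mul_add_one hq]
  linarith

lemma IsCL21Placement.exists_fallbackDelivery (hP : IsCL21Placement Nh P) (hq : K = 2 * q + 1)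
    (d : Fin K → Fin N) {F b : ℕ} (split : Fin F ≃ Pair K × Fin b) :
    ∃ D, IsFallbackDelivery P d D ∧ Decodable split P d D ∧ #D = K.choose 2 * q := by
  obtain ⟨w, hw, hcard⟩ := exists_even_owner hq
  let P' : Placement K N := fun n I => if n.val < Nh then {w I} else P n I
  have hP'P : ∀ n I, P' n I ⊆ P n I := fun n I => by
    by_cases hn : n.val < Nh
    · simp [P', hn, hP.1 n hn I, hw I]
    · simp [P', hn]
  have heven : ∀ n, EvenlySplit P' n := fun n => by
    by_cases hn : n.val < Nh
    · exact evenlySplit_of_eq_singleton hq (fun I => if_pos hn) hcard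
    · simpa only [EvenlySplit, P', if_neg hn] using hP.2 n (not_lt.1 hn)
  obtain ⟨D, hlevel, hD, hcard⟩ := exists_isLevelOneDelivery_univ (fun u => heven (d u)) hq
  refine ⟨D, ⟨P', hP'P, fun u => heven (d u), hlevel⟩, (hD.mono hP'P).decodable ?_ split, hcard⟩
  exact fun x hx => mem_requests.2 fun h => mem_requests.1 hx (hP'P _ _ h)

end Fallback

section Triples

/-- The message of the level-2 coded delivery for a set `S` of three users. -/
def tripleMessage (S : Finset (Fin K)) : Message K :=
  ({x | x.1 ∈ S ∧ x.2.1 = S.erase x.1} : Finset (Fin K × Pair K))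

lemma mem_tripleMessage {S : Finset (Fin K)} {x : Fin K × Pair K} :
    x ∈ tripleMessage S ↔ x.1 ∈ S ∧ x.2.1 = S.erase x.1 := mem_filter_univ _

lemma mem_tripleMessages {H : Finset (Fin K)} {m : Message K} :
    m ∈ tripleMessages H ↔ ∃ S, (S ⊆ H ∧ #S = 3) ∧ tripleMessage S = m := by
  simp only [tripleMessages, mem_image, mem_powersetCard, tripleMessage]

lemma injOn_fst_tripleMessage (S : Finset (Fin K)) :
    Set.InjOn Prod.fst (tripleMessage S : Set (Fin K × Pair K)) := by
  intro x hx y hy hxy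
  refine Prod.ext hxy (Subtype.ext ?_)
  rw [(mem_tripleMessage.1 hx).2, (mem_tripleMessage.1 hy).2, hxy]

lemma image_fst_tripleMessage {S : Finset (Fin K)} (hS : #S = 3) :
    (tripleMessage S).image Prod.fst = S := by
  ext u
  simp only [mem_image, mem_tripleMessage]
  refine ⟨?_, fun hu => ⟨(u, ⟨S.erase u, by rw [card_erase_of_mem hu, hS]⟩), ⟨hu, rfl⟩, rfl⟩⟩
  rintro ⟨x, hx, rfl⟩
  exact hx.1

lemma card_of_mem_tripleMessages {H : Finset (Fin K)} {m : Message K}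
    (hm : m ∈ tripleMessages H) : #m = 3 := by
  obtain ⟨S, ⟨-, hS⟩, rfl⟩ := mem_tripleMessages.1 hm
  rw [← card_image_of_injOn (injOn_fst_tripleMessage S), image_fst_tripleMessage hS, hS]

lemma card_tripleMessages (H : Finset (Fin K)) : #(tripleMessages H) = (#H).choose 3 := by
  rw [← card_powersetCard]
  refine card_image_of_injOn fun S hS S' hS' h => ?_
  rw [← image_fst_tripleMessage (mem_powersetCard.1 hS).2,
    ← image_fst_tripleMessage (mem_powersetCard.1 hS').2]
  exact congrArg _ h

/-- The requests that are served by the level-2 coded delivery within `H` if every sub-file is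
cached by exactly the users in its index. -/
def tripleRequests (H : Finset (Fin K)) : Finset (Fin K × Pair K) :=
  {x | x.1 ∉ x.2.1 ∧ x.1 ∈ H ∧ x.2.1 ⊆ H}

lemma mem_tripleRequests {H : Finset (Fin K)} {x : Fin K × Pair K} :
    x ∈ tripleRequests H ↔ x.1 ∉ x.2.1 ∧ x.1 ∈ H ∧ x.2.1 ⊆ H := mem_filter_univ _

lemma delivers_tripleMessages {P : Placement K N} {d : Fin K → Fin N} {H : Finset (Fin K)}
    (hP : ∀ u ∈ H, ∀ I, P (d u) I = I.1) :
    Delivers P d (tripleMessages H) (tripleRequests H) where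
  pairwiseDisjoint m hm m' hm' hne := by
    obtain ⟨S, -, rfl⟩ := mem_tripleMessages.1 hm
    obtain ⟨S', -, rfl⟩ := mem_tripleMessages.1 hm'
    refine disjoint_left.2 fun x hx hx' => hne (congrArg _ ?_)
    obtain ⟨hxS, hx⟩ := mem_tripleMessage.1 hx
    obtain ⟨hxS', hx'⟩ := mem_tripleMessage.1 hx'
    rw [← insert_erase hxS, ← hx, hx', insert_erase hxS']
  biUnion_eq := by
    ext x
    simp only [mem_biUnion, id_eq, mem_tripleMessages, mem_tripleRequests]
    constructor
    · rintro ⟨_, ⟨S, ⟨hSH, -⟩, rfl⟩, hx⟩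
      obtain ⟨hxS, hx⟩ := mem_tripleMessage.1 hx
      exact ⟨hx ▸ notMem_erase _ _, hSH hxS, hx ▸ (erase_subset _ _).trans hSH⟩
    · rintro ⟨hx, hxH, hIH⟩
      exact ⟨_, ⟨insert x.1 x.2.1, ⟨insert_subset hxH hIH, by rw [card_insert_of_notMem hx, x.2.2]⟩,
        rfl⟩, mem_tripleMessage.2 ⟨mem_insert_self _ _, (erase_insert hx).symm⟩⟩
  nonempty m hm := card_pos.1 (by rw [card_of_mem_tripleMessages hm]; norm_num)
  cached m hm x hx y hy hxy := by
    obtain ⟨S, ⟨hSH, -⟩, rfl⟩ := mem_tripleMessages.1 hm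
    obtain ⟨hyS, hy'⟩ := mem_tripleMessage.1 hy
    rw [hP _ (hSH hyS), hy', mem_erase]
    exact ⟨fun h => hxy (injOn_fst_tripleMessage S hx hy h), (mem_tripleMessage.1 hx).1⟩

end Triples

section HighShare

variable {L : Finset (Fin K)} {δ : Fin K → ℕ} {q : ℕ} {w : Pair K → Fin K}
  {T U : Fin K → Fin K → Finset (Fin K)} {u v j k : Fin K} {I : Pair K}

/-- The sub-files that a high-level user `u` receives in exchange with user `v`, where `L` is the
set of low-level users. The pairs inside `L` are distributed by `w`; a pair `{j, k}` with `j ∈ L`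
and `k ∉ L` is received from `j` if `k ∉ T j u`, from `k` if `k ∈ U j u`, and uncoded otherwise. -/
def highShare (L : Finset (Fin K)) (w : Pair K → Fin K) (T U : Fin K → Fin K → Finset (Fin K))
    (u v : Fin K) : Finset (Pair K) :=
  if v ∈ L then owned L w v ∪ star v (Lᶜ.erase u \ T v u) else star v {j ∈ L | v ∈ U j u}

/-- The requests of high-level users that are served by unicast messages. -/
def uncoded (L : Finset (Fin K)) (T U : Fin K → Fin K → Finset (Fin K)) :
    Finset (Fin K × Pair K) :=
  {x | x.1 ∉ L ∧ ∃ j ∈ L, x.2 ∈ star j (T j x.1 \ U j x.1)}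

/-- A choice of the data of `highShare` for which any two high-level users receive equally many
sub-files from each other, and every high-level user receives `q` sub-files from every user in
`L`. -/
structure IsHighPlan (L : Finset (Fin K)) (δ : Fin K → ℕ) (q : ℕ) (w : Pair K → Fin K)
    (T U : Fin K → Fin K → Finset (Fin K)) : Prop extends IsNearlySymmetric L Lᶜ δ T U where
  owner_mem : ∀ I : Pair K, I.1 ⊆ L → w I ∈ I.1
  card_owned_le : ∀ j ∈ L, ∀ k ∈ L, #(owned L w j) ≤ #(owned L w k) + 1
  card_owned_add : ∀ j ∈ L, #(owned L w j) + #Lᶜ = q + δ j + 1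

lemma exists_isHighPlan (hq : K = 2 * q + 1) (hL : 2 ≤ #Lᶜ) :
    ∃ δ w T U, IsHighPlan L δ q w T U := by
  obtain ⟨w, hw, hcard⟩ := exists_balanced_owner L
  have hLK : #L + #Lᶜ = 2 * q + 1 := by rw [card_add_card_compl, Fintype.card_fin, hq]
  obtain ⟨T, U, hTU⟩ := exists_isNearlySymmetric (J := L) (H := Lᶜ)
    (δ := fun j => #(owned L w j) + #Lᶜ - 1 - q) fun j hj => by have := hcard j hj; omega
  refine ⟨_, w, T, U, hTU, hw, fun j hj k hk => ?_, fun j hj => ?_⟩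
  · have := hcard j hj
    have := hcard k hk
    omega
  · have := hcard j hj
    omega

lemma mem_uncoded {x : Fin K × Pair K} :
    x ∈ uncoded L T U ↔ x.1 ∉ L ∧ ∃ j ∈ L, x.2 ∈ star j (T j x.1 \ U j x.1) := mem_filter_univ _

lemma mem_highShare_of_subset (hw : ∀ I : Pair K, I.1 ⊆ L → w I ∈ I.1) (hI : I.1 ⊆ L) :
    I ∈ highShare L w T U u v ↔ v = w I := by
  have hwI := hI (hw I hI)
  by_cases hv : v ∈ L
  · rw [highShare, if_pos hv, mem_union, mem_owned, mem_star]
    grind [mem_compl]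
  · rw [highShare, if_neg hv, mem_star]
    grind [mem_compl]

lemma notMem_highShare_of_subset_compl (hI : I.1 ⊆ Lᶜ) : I ∉ highShare L w T U u v := by
  obtain ⟨j, k, -, hjk⟩ := card_eq_two.1 I.2
  have hj : j ∉ L := mem_compl.1 (hI (by simp [hjk]))
  have hk : k ∉ L := mem_compl.1 (hI (by simp [hjk]))
  rw [highShare]
  split_ifs <;>
    simp only [mem_union, mem_owned, hjk, insert_subset_iff, mem_star_of_eq_pair hjk] <;>
    grind

lemma mem_highShare_of_eq_pair (hj : j ∈ L) (hk : k ∉ L) (hI : I.1 = {j, k}) :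
    I ∈ highShare L w T U u v ↔ (v = j ∧ k ∈ Lᶜ.erase u \ T j u) ∨ (v = k ∧ k ∈ U j u) := by
  by_cases hv : v ∈ L
  · rw [highShare, if_pos hv, mem_union, mem_owned, mem_star_of_eq_pair hI]
    grind [mem_compl]
  · rw [highShare, if_neg hv, mem_star_of_eq_pair hI]
    grind [mem_compl]

lemma exists_mem_star_of_eq_pair {B : Fin K → Finset (Fin K)} (hj : j ∈ L) (hk : k ∉ L)
    (hI : I.1 = {j, k}) : (∃ j ∈ L, I ∈ star j (B j)) ↔ k ∈ B j := by
  simp only [mem_star_of_eq_pair hI]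
  grind

lemma mem_uncoded_of_eq_pair (hu : u ∉ L) (hj : j ∈ L) (hk : k ∉ L) (hI : I.1 = {j, k}) :
    (u, I) ∈ uncoded L T U ↔ k ∈ T j u \ U j u := by
  rw [mem_uncoded, exists_mem_star_of_eq_pair hj hk hI, and_iff_right hu]

namespace IsHighPlan

variable (h : IsHighPlan L δ q w T U)
include h

lemma subset_compl_erase (hj : j ∈ L) (hu : u ∉ L) : T j u ⊆ Lᶜ.erase u :=
  h.subset_erase j hj u (mem_compl.2 hu)

lemma subset_of_notMem (hj : j ∈ L) (hu : u ∉ L) : U j u ⊆ T j u :=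
  h.subset j hj u (mem_compl.2 hu)

lemma notMem_and_mem_of_mem_highShare (hu : u ∉ L) (hI : I ∈ highShare L w T U u v) :
    u ∉ I.1 ∧ v ∈ I.1 := by
  obtain hIL | hIL | ⟨j, hj, k, hk, hjk⟩ := I.subset_or_subset_compl_or_exists_eq_pair L
  · obtain rfl := (mem_highShare_of_subset h.owner_mem hIL).1 hI
    exact ⟨fun huI => hu (hIL huI), h.owner_mem I hIL⟩
  · exact absurd hI (notMem_highShare_of_subset_compl hIL)
  · have hsub := h.subset_compl_erase hj hu
    have hsub' := h.subset_of_notMem hj hu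
    rw [mem_highShare_of_eq_pair hj hk hjk] at hI
    rw [hjk]
    grind

lemma eq_of_mem_highShare {v' : Fin K} (hu : u ∉ L) (hv : I ∈ highShare L w T U u v)
    (hv' : I ∈ highShare L w T U u v') : v = v' := by
  obtain hIL | hIL | ⟨j, hj, k, hk, hjk⟩ := I.subset_or_subset_compl_or_exists_eq_pair L
  · rw [mem_highShare_of_subset h.owner_mem hIL] at hv hv'
    exact hv.trans hv'.symm
  · exact absurd hv (notMem_highShare_of_subset_compl hIL)
  · have hsub' := h.subset_of_notMem hj hu
    rw [mem_highShare_of_eq_pair hj hk hjk] at hv hv'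
    grind

lemma exists_eq_pair_of_mem_uncoded (hI : (u, I) ∈ uncoded L T U) :
    u ∉ L ∧ ∃ j ∈ L, ∃ k ∉ L, I.1 = {j, k} ∧ k ∈ T j u \ U j u := by
  obtain ⟨hu, j, hj, hI⟩ := mem_uncoded.1 hI
  obtain ⟨k, hk, hjk⟩ := mem_star.1 hI
  have hkL := h.subset_compl_erase hj hu (mem_sdiff.1 hk).1
  exact ⟨hu, j, hj, k, mem_compl.1 (mem_erase.1 hkL).2, hjk, hk⟩

lemma card_uncoded_le_one : #(uncoded L T U) ≤ 1 := by
  refine card_le_one.2 fun ⟨u, I⟩ hI ⟨u', I'⟩ hI' => ?_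
  obtain ⟨hu, j, hj, k, -, hjk, hk⟩ := h.exists_eq_pair_of_mem_uncoded hI
  obtain ⟨hu', j', hj', k', -, hjk', hk'⟩ := h.exists_eq_pair_of_mem_uncoded hI'
  obtain ⟨rfl, rfl, rfl⟩ :=
    h.deleted_unique j hj j' hj' u (mem_compl.2 hu) u' (mem_compl.2 hu') k hk k' hk'
  exact Prod.ext rfl (Subtype.ext (hjk.trans hjk'.symm))

lemma notMem_highShare_of_mem_uncoded (hI : (u, I) ∈ uncoded L T U) :
    I ∉ highShare L w T U u v := by
  obtain ⟨-, j, hj, k, hk, hjk, hkTU⟩ := h.exists_eq_pair_of_mem_uncoded hI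
  rw [mem_highShare_of_eq_pair hj hk hjk]
  grind

lemma notMem_iff (hu : u ∉ L) : u ∉ I.1 ↔
    (u ∉ I.1 ∧ I.1 ⊆ Lᶜ) ∨ (∃ v, I ∈ highShare L w T U u v) ∨ (u, I) ∈ uncoded L T U := by
  constructor
  · intro huI
    obtain hIL | hIL | ⟨j, hj, k, hk, hjk⟩ := I.subset_or_subset_compl_or_exists_eq_pair L
    · exact Or.inr (Or.inl ⟨w I, (mem_highShare_of_subset h.owner_mem hIL).2 rfl⟩)
    · exact Or.inl ⟨huI, hIL⟩
    · simp only [mem_highShare_of_eq_pair hj hk hjk, mem_uncoded_of_eq_pair hu hj hk hjk]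
      grind [mem_compl]
  · rintro (⟨huI, -⟩ | ⟨v, hI⟩ | hI)
    · exact huI
    · exact (h.notMem_and_mem_of_mem_highShare hu hI).1
    · obtain ⟨-, j, hj, k, -, hjk, hkTU⟩ := h.exists_eq_pair_of_mem_uncoded hI
      have hsub := h.subset_compl_erase hj hu
      rw [hjk]
      grind

lemma exists_mem_star_iff (hu : u ∉ L) : (∃ j ∈ L, I ∈ star j (T j u)) ↔
    (∃ v ∉ L, I ∈ highShare L w T U u v) ∨ (u, I) ∈ uncoded L T U := by
  constructor
  · rintro ⟨j, hj, hI⟩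
    obtain ⟨k, hkT, hjk⟩ := mem_star.1 hI
    have hk : k ∉ L := mem_compl.1 (mem_erase.1 (h.subset_compl_erase hj hu hkT)).2
    by_cases hkU : k ∈ U j u
    · exact Or.inl ⟨k, hk, (mem_highShare_of_eq_pair hj hk hjk).2 (Or.inr ⟨rfl, hkU⟩)⟩
    · exact Or.inr ((mem_uncoded_of_eq_pair hu hj hk hjk).2 (mem_sdiff.2 ⟨hkT, hkU⟩))
  · rintro (⟨v, hv, hI⟩ | hI)
    · rw [highShare, if_neg hv] at hI
      obtain ⟨j, hj, hvj⟩ := mem_star.1 hI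
      obtain ⟨hj, hvU⟩ := mem_filter.1 hj
      exact ⟨j, hj, mem_star.2 ⟨v, h.subset_of_notMem hj hu hvU, hvj.trans (pair_comm v j)⟩⟩
    · obtain ⟨-, j, hj, k, -, hjk, hk⟩ := h.exists_eq_pair_of_mem_uncoded hI
      exact ⟨j, hj, mem_star.2 ⟨k, (mem_sdiff.1 hk).1, hjk⟩⟩

lemma card_highShare_low (hu : u ∉ L) (hv : v ∈ L) : #(highShare L w T U u v) = q := by
  have hdisj : Disjoint (owned L w v) (star v (Lᶜ.erase u \ T v u)) := by
    refine disjoint_left.2 fun I hI hI' => ?_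
    obtain ⟨k, hk, hvk⟩ := mem_star.1 hI'
    have := (mem_owned.1 hI).1
    grind [mem_compl]
  have hv' : v ∉ Lᶜ.erase u \ T v u := by simp [hv]
  have howned := h.card_owned_add v hv
  have hpos : 0 < #Lᶜ := card_pos.2 ⟨u, mem_compl.2 hu⟩
  have hδ := card_le_card (h.subset_compl_erase hv hu)
  rw [h.card_eq v hv u (mem_compl.2 hu), card_erase_of_mem (mem_compl.2 hu)] at hδ
  rw [highShare, if_pos hv, card_union_of_disjoint hdisj, card_star hv',
    card_sdiff_of_subset (h.subset_compl_erase hv hu), card_erase_of_mem (mem_compl.2 hu),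
    h.card_eq v hv u (mem_compl.2 hu)]
  omega

lemma card_highShare_comm (hu : u ∉ L) (hv : v ∉ L) :
    #(highShare L w T U u v) = #(highShare L w T U v u) := by
  rw [highShare, if_neg hv, highShare, if_neg hu, card_star (by simp [hv]),
    card_star (by simp [hu])]
  exact h.balanced u (mem_compl.2 hu) v (mem_compl.2 hv)

end IsHighPlan

end HighShare

section FourStep

variable {Nh q : ℕ} {P : Placement K N} {d : Fin K → Fin N} {δ : Fin K → ℕ} {w : Pair K → Fin K}
  {T U : Fin K → Fin K → Finset (Fin K)} {u v : Fin K} {I : Pair K}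

lemma mem_lowUsers : u ∈ lowUsers Nh d ↔ Nh ≤ (d u).val := mem_filter_univ _

lemma highUsers_eq_compl (Nh : ℕ) (d : Fin K → Fin N) : highUsers Nh d = (lowUsers Nh d)ᶜ := by
  rw [lowUsers_eq_compl, compl_compl]

lemma mem_highUsers : u ∈ highUsers Nh d ↔ u ∉ lowUsers Nh d := by
  rw [highUsers_eq_compl, mem_compl]

namespace IsCL21Placement

variable (hP : IsCL21Placement Nh P)
include hP

lemma eq_of_notMem_lowUsers (hu : u ∉ lowUsers Nh d) (I : Pair K) : P (d u) I = I.1 :=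
  hP.1 _ (not_le.1 (mt mem_lowUsers.2 hu)) I

lemma evenlySplit (hu : u ∈ lowUsers Nh d) : EvenlySplit P (d u) :=
  hP.2 _ (mem_lowUsers.1 hu)

lemma mem_avail_iff (hu : u ∉ lowUsers Nh d) : I ∈ avail P d u v ↔ u ∉ I.1 ∧ v ∈ I.1 := by
  rw [mem_avail, hP.eq_of_notMem_lowUsers hu]

lemma Omega_eq_star (hu : u ∉ lowUsers Nh d) (hv : v ∈ lowUsers Nh d) :
    Omega Nh P d u v = star v ((lowUsers Nh d)ᶜ.erase u) := by
  ext I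
  simp only [Omega, mem_filter, hP.mem_avail_iff hu, mem_highUsers, hP.eq_of_notMem_lowUsers hu,
    mem_star, mem_erase, mem_compl]
  constructor
  · rintro ⟨⟨huI, hvI⟩, k, hk, hkI⟩
    have hvk : v ≠ k := fun h => hk (h ▸ hv)
    exact ⟨k, ⟨fun h => huI (h ▸ hkI), hk⟩, Pair.eq_pair hvI hkI hvk⟩
  · rintro ⟨k, ⟨hku, hk⟩, hI⟩
    rw [hI]
    grind

lemma Lam_eq (hu : u ∉ lowUsers Nh d) :
    Lam Nh P d u = ({I | I.1 ⊆ lowUsers Nh d} : Finset (Pair K)) := by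
  ext I
  simp only [Lam, missing, mem_filter, mem_univ, true_and, hP.eq_of_notMem_lowUsers hu,
    and_iff_right_iff_imp]
  exact fun hI huI => hu (hI huI)

end IsCL21Placement

/-- The sub-files that user `u` receives in exchange with user `v` in the four-step delivery. -/
def share (Nh : ℕ) (P : Placement K N) (d : Fin K → Fin N) (w : Pair K → Fin K)
    (T U : Fin K → Fin K → Finset (Fin K)) (u v : Fin K) : Finset (Pair K) :=
  if u ∈ lowUsers Nh d then avail P d u v else highShare (lowUsers Nh d) w T U u v

lemma share_of_mem (hu : u ∈ lowUsers Nh d) : share Nh P d w T U u v = avail P d u v := if_pos hu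

lemma share_of_notMem (hu : u ∉ lowUsers Nh d) :
    share Nh P d w T U u v = highShare (lowUsers Nh d) w T U u v := if_neg hu

/-- The exchanging pairs of users in the four-step delivery, each with a chosen orientation. -/
def exchangeArcs (Nh : ℕ) (d : Fin K → Fin N) : Finset (Fin K × Fin K) :=
  ascendingPairs (lowUsers Nh d) ∪ highUsers Nh d ×ˢ lowUsers Nh d ∪ ascendingPairs (highUsers Nh d)

lemma mem_exchangeArcs :
    (u, v) ∈ exchangeArcs Nh d ↔ ((u ∈ lowUsers Nh d ↔ v ∈ lowUsers Nh d) ∧ u < v) ∨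
      (u ∉ lowUsers Nh d ∧ v ∈ lowUsers Nh d) := by
  simp only [exchangeArcs, mem_union, mem_ascendingPairs, mem_product, mem_highUsers]
  tauto

lemma exchangeArcs_asymm (h : (u, v) ∈ exchangeArcs Nh d) : (v, u) ∉ exchangeArcs Nh d := by
  rw [mem_exchangeArcs] at h ⊢
  have := @lt_asymm _ _ u v
  tauto

lemma exchangeArcs_total (huv : u ≠ v) :
    (u, v) ∈ exchangeArcs Nh d ∨ (v, u) ∈ exchangeArcs Nh d := by
  rw [mem_exchangeArcs, mem_exchangeArcs]
  have := lt_or_gt_of_ne huv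
  tauto

lemma disjoint_served_uncoded (h : IsHighPlan (lowUsers Nh d) δ q w T U)
    (E : Finset (Fin K × Fin K)) :
    Disjoint (served E (share Nh P d w T U)) (uncoded (lowUsers Nh d) T U) := by
  refine disjoint_left.2 fun ⟨u, I⟩ hx hx' => ?_
  obtain ⟨v, -, hv⟩ := mem_served.1 hx
  rw [share_of_notMem (mem_uncoded.1 hx').1] at hv
  exact h.notMem_highShare_of_mem_uncoded hx' hv

lemma disjoint_tripleRequests (h : IsHighPlan (lowUsers Nh d) δ q w T U)
    (E : Finset (Fin K × Fin K)) :
    Disjoint (tripleRequests (highUsers Nh d))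
      (served E (share Nh P d w T U) ∪ uncoded (lowUsers Nh d) T U) := by
  refine disjoint_left.2 fun ⟨u, I⟩ hx hx' => ?_
  obtain ⟨-, hu, hI⟩ := mem_tripleRequests.1 hx
  rw [highUsers_eq_compl] at hI
  rcases mem_union.1 hx' with hx' | hx'
  · obtain ⟨v, -, hv⟩ := mem_served.1 hx'
    rw [share_of_notMem (mem_highUsers.1 hu)] at hv
    exact notMem_highShare_of_subset_compl hI hv
  · obtain ⟨-, j, hj, k, -, hjk, -⟩ := h.exists_eq_pair_of_mem_uncoded hx'
    exact mem_compl.1 (hI (hjk ▸ mem_insert_self j {k})) hj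

lemma isCrossDelivery_pairing (hP : IsCL21Placement Nh P)
    {e : Fin K → Fin K → Pair K → Pair K} (he : IsMatching (share Nh P d w T U) e) :
    IsCrossDelivery Nh P d
      (fun i j => owned (lowUsers Nh d) w j ∪ (Omega Nh P d i j \ star j (T j i)))
      (pairing (highUsers Nh d ×ˢ lowUsers Nh d) (share Nh P d w T U) e) := by
  have hshare : ∀ i ∈ highUsers Nh d, ∀ j ∈ lowUsers Nh d,
      owned (lowUsers Nh d) w j ∪ (Omega Nh P d i j \ star j (T j i)) =
        share Nh P d w T U i j := fun i hi j hj => by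
    rw [mem_highUsers] at hi
    rw [hP.Omega_eq_star hi hj, star_sdiff, share_of_notMem hi, highShare, if_pos hj]
  refine ⟨e, fun i hi j hj => ?_, fun m => ?_⟩
  · simpa only [hshare i hi j hj, share_of_mem hj] using he i j
  · simp only [mem_pairing, mem_product]
    constructor
    · rintro ⟨i, j, ⟨hi, hj⟩, I, hI, rfl⟩
      exact ⟨i, hi, j, hj, I, hshare i hi j hj ▸ hI, rfl⟩
    · rintro ⟨i, hi, j, hj, I, hI, rfl⟩
      exact ⟨i, j, ⟨hi, hj⟩, I, hshare i hi j hj ▸ hI, rfl⟩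

section Plan

variable (hP : IsCL21Placement Nh P) (h : IsHighPlan (lowUsers Nh d) δ q w T U)
include hP h

lemma share_subset_avail : share Nh P d w T U u v ⊆ avail P d u v := by
  by_cases hu : u ∈ lowUsers Nh d
  · rw [share_of_mem hu]
  · rw [share_of_notMem hu]
    exact fun I hI => (hP.mem_avail_iff hu).2 (h.notMem_and_mem_of_mem_highShare hu hI)

lemma isExchangePlan_share (hq : K = 2 * q + 1) : IsExchangePlan P d (share Nh P d w T U) where
  subset_avail _ _ := share_subset_avail hP h
  eq_of_mem u v v' I hv hv' := by
    by_cases hu : u ∈ lowUsers Nh d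
    · rw [share_of_mem hu, mem_avail] at hv hv'
      exact (hP.evenlySplit hu).eq_of_mem hv.2 hv'.2
    · rw [share_of_notMem hu] at hv hv'
      exact h.eq_of_mem_highShare hu hv hv'
  card_comm u v := by
    rcases eq_or_ne u v with rfl | huv
    · rfl
    by_cases hu : u ∈ lowUsers Nh d <;> by_cases hv : v ∈ lowUsers Nh d
    · rw [share_of_mem hu, share_of_mem hv, (hP.evenlySplit hu).card_avail hq huv,
        (hP.evenlySplit hv).card_avail hq huv.symm]
    · rw [share_of_mem hu, share_of_notMem hv, (hP.evenlySplit hu).card_avail hq huv,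
        h.card_highShare_low hv hu]
    · rw [share_of_notMem hu, share_of_mem hv, (hP.evenlySplit hv).card_avail hq huv.symm,
        h.card_highShare_low hu hv]
    · rw [share_of_notMem hu, share_of_notMem hv, h.card_highShare_comm hu hv]

lemma ne_of_mem_share (hI : I ∈ share Nh P d w T U u v) : u ≠ v := by
  rintro rfl
  obtain ⟨hu, hu'⟩ := mem_avail.1 (share_subset_avail hP h hI)
  exact hu hu'

lemma mem_served_exchangeArcs : (u, I) ∈ served (exchangeArcs Nh d) (share Nh P d w T U) ↔
    ∃ v, I ∈ share Nh P d w T U u v := by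
  rw [mem_served]
  exact ⟨fun ⟨v, _, hI⟩ => ⟨v, hI⟩,
    fun ⟨v, hI⟩ => ⟨v, exchangeArcs_total (ne_of_mem_share hP h hI), hI⟩⟩

lemma mem_served_ascendingPairs_highUsers :
    (u, I) ∈ served (ascendingPairs (highUsers Nh d)) (share Nh P d w T U) ↔
      u ∉ lowUsers Nh d ∧ ∃ v ∉ lowUsers Nh d, I ∈ highShare (lowUsers Nh d) w T U u v := by
  simp only [mem_served, mem_ascendingPairs, mem_highUsers]
  constructor
  · rintro ⟨v, ⟨⟨hu, hv⟩, -⟩ | ⟨⟨hv, hu⟩, -⟩, hI⟩ <;>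
      exact ⟨hu, v, hv, share_of_notMem hu ▸ hI⟩
  · rintro ⟨hu, v, hv, hI⟩
    rw [← share_of_notMem hu] at hI
    have := lt_or_gt_of_ne (ne_of_mem_share hP h hI)
    exact ⟨v, by tauto, hI⟩

lemma requests_eq_union : requests P d = tripleRequests (highUsers Nh d) ∪
    (served (exchangeArcs Nh d) (share Nh P d w T U) ∪ uncoded (lowUsers Nh d) T U) := by
  ext ⟨u, I⟩
  rw [mem_union, mem_union, mem_tripleRequests, mem_served_exchangeArcs hP h, mem_requests,
    highUsers_eq_compl, mem_compl]
  by_cases hu : u ∈ lowUsers Nh d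
  · obtain ⟨v, hv⟩ := (hP.evenlySplit hu).exists_mem I
    simp only [share_of_mem hu, mem_avail, mem_uncoded, hu]
    grind
  · simp only [share_of_notMem hu, hP.eq_of_notMem_lowUsers hu, hu, not_false_iff, true_and]
    exact h.notMem_iff hu

lemma isLamPartition_owned : IsLamPartition Nh P d (owned (lowUsers Nh d) w) := by
  refine ⟨fun i hi => ⟨?_, fun j hj I hI => ?_⟩, fun j _ k _ hjk => ?_, h.card_owned_le⟩
  · rw [hP.Lam_eq (mem_highUsers.1 hi)]
    ext I
    simp only [mem_biUnion, mem_owned, mem_filter_univ]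
    exact ⟨fun ⟨_, _, hI, _⟩ => hI, fun hI => ⟨w I, hI (h.owner_mem I hI), hI, rfl⟩⟩
  · obtain ⟨hIL, rfl⟩ := mem_owned.1 hI
    exact (hP.mem_avail_iff (mem_highUsers.1 hi)).2
      ⟨fun hiI => mem_highUsers.1 hi (hIL hiI), h.owner_mem I hIL⟩
  · exact disjoint_left.2 fun I hI hI' => hjk ((mem_owned.1 hI).2.symm.trans (mem_owned.1 hI').2)

lemma star_subset_Omega (hu : u ∉ lowUsers Nh d) (hv : v ∈ lowUsers Nh d) :
    star v (T v u) ⊆ Omega Nh P d u v := by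
  rw [hP.Omega_eq_star hu hv]
  intro I hI
  obtain ⟨k, hk, hI⟩ := mem_star.1 hI
  exact mem_star.2 ⟨k, h.subset_compl_erase hv hu hk, hI⟩

variable {e : Fin K → Fin K → Pair K → Pair K} (he : IsMatching (share Nh P d w T U) e)
include he

lemma isResidualDelivery (hq : K = 2 * q + 1) :
    IsResidualDelivery Nh P d (fun i j => star j (T j i))
      (pairing (ascendingPairs (highUsers Nh d)) (share Nh P d w T U) e ∪
        (uncoded (lowUsers Nh d) T U).image singleton) := by
  have hD := ((isExchangePlan_share hP h hq).delivers_pairing he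
    fun _ _ => ascendingPairs_asymm).union (delivers_image_singleton P d _)
      (disjoint_served_uncoded h (ascendingPairs (highUsers Nh d)))
  refine ⟨fun ⟨u, I⟩ => ?_, hD.pairwiseDisjoint, fun m hm => ?_, ?_⟩
  · rw [hD.exists_mem_iff, mem_union, mem_served_ascendingPairs_highUsers hP h, mem_highUsers]
    by_cases hu : u ∈ lowUsers Nh d
    · simp only [mem_uncoded, hu, not_true_eq_false, false_and, or_self]
    · rw [h.exists_mem_star_iff hu, and_iff_right hu, and_iff_right hu]
  · rcases mem_union.1 hm with hm | hm
    · obtain ⟨i, k, hik, I, hI, rfl⟩ := mem_pairing.1 hm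
      obtain ⟨⟨hi, hk⟩, hlt⟩ := mem_ascendingPairs.1 hik
      exact Or.inr ⟨i, hi, k, hk, hlt.ne, I, share_subset_avail hP h hI, e i k I,
        share_subset_avail hP h ((he i k).mapsTo hI), rfl⟩
    · obtain ⟨x, -, rfl⟩ := mem_image.1 hm
      exact Or.inl ⟨x, rfl⟩
  · have hsub : {m ∈ pairing (ascendingPairs (highUsers Nh d)) (share Nh P d w T U) e ∪
        (uncoded (lowUsers Nh d) T U).image singleton | #m = 1} ⊆
          (uncoded (lowUsers Nh d) T U).image singleton := fun m hm => by
      obtain ⟨hm, hcard⟩ := mem_filter.1 hm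
      refine (mem_union.1 hm).resolve_left fun hm => ?_
      have := card_of_mem_pairing (fun _ _ => ascendingPairs_asymm) hm
      omega
    exact (card_le_card hsub).trans (card_image_le.trans h.card_uncoded_le_one)

end Plan

/-- The messages of the four-step delivery. -/
def fourStepMessages (Nh : ℕ) (P : Placement K N) (d : Fin K → Fin N) (w : Pair K → Fin K)
    (T U : Fin K → Fin K → Finset (Fin K)) (e : Fin K → Fin K → Pair K → Pair K) :
    Finset (Message K) :=
  tripleMessages (highUsers Nh d) ∪ (pairing (exchangeArcs Nh d) (share Nh P d w T U) e ∪
    (uncoded (lowUsers Nh d) T U).image singleton)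

section FourStepMessages

variable (hP : IsCL21Placement Nh P) (h : IsHighPlan (lowUsers Nh d) δ q w T U)
  {e : Fin K → Fin K → Pair K → Pair K} (he : IsMatching (share Nh P d w T U) e)
  (hq : K = 2 * q + 1)
include hP h he hq

lemma isFourStepDelivery_fourStepMessages :
    IsFourStepDelivery Nh P d (fourStepMessages Nh P d w T U e) :=
  ⟨_, _, _, _, _, by simp only [fourStepMessages, exchangeArcs, pairing_union, union_assoc],
    isLevelOneDelivery_pairing he fun _ hu => funext fun _ => share_of_mem hu,
    isLamPartition_owned hP h,
    fun _ hi _ hj => star_subset_Omega hP h (mem_highUsers.1 hi) hj,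
    isCrossDelivery_pairing hP he, isResidualDelivery hP h he hq⟩

lemma delivers_fourStepMessages :
    Delivers P d (fourStepMessages Nh P d w T U e) (requests P d) := by
  rw [requests_eq_union hP h]
  exact (delivers_tripleMessages fun _ hu => hP.eq_of_notMem_lowUsers (mem_highUsers.1 hu)).union
    (((isExchangePlan_share hP h hq).delivers_pairing he fun _ _ => exchangeArcs_asymm).union
      (delivers_image_singleton P d _) (disjoint_served_uncoded h _)) (disjoint_tripleRequests h _)

lemma card_fourStepMessages :
    2 * #(fourStepMessages Nh P d w T U e) + (#(highUsers Nh d)).choose 3 =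
      ∑ u, #(missing P d u) + #(uncoded (lowUsers Nh d) T U) := by
  have hpairs := (isExchangePlan_share hP h hq).delivers_pairing he
    fun _ _ => exchangeArcs_asymm (Nh := Nh) (d := d)
  have hsingles := delivers_image_singleton P d (uncoded (lowUsers Nh d) T U)
  have htriples : Delivers P d (tripleMessages (highUsers Nh d)) _ :=
    delivers_tripleMessages fun _ hu => hP.eq_of_notMem_lowUsers (mem_highUsers.1 hu)
  have hdisj := disjoint_served_uncoded (P := P) (w := w) h (exchangeArcs Nh d)
  have hdisj' := disjoint_tripleRequests (P := P) (w := w) h (exchangeArcs Nh d)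
  have hcard₃ := htriples.card_eq_mul fun _ => card_of_mem_tripleMessages
  have hcard₂ := hpairs.card_eq_mul fun _ => card_of_mem_pairing fun _ _ => exchangeArcs_asymm
  rw [card_tripleMessages] at hcard₃
  rw [← card_requests, requests_eq_union hP h, card_union_of_disjoint hdisj',
    card_union_of_disjoint hdisj, hcard₃, hcard₂, fourStepMessages,
    card_union_of_disjoint (htriples.disjoint (hpairs.union hsingles hdisj) hdisj'),
    card_union_of_disjoint (hpairs.disjoint hsingles hdisj), card_tripleMessages,
    card_image_of_injective _ singleton_injective]
  ring

end FourStepMessages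

lemma IsCL21Placement.exists_fourStepDelivery (hP : IsCL21Placement Nh P) (hq : K = 2 * q + 1)
    (d : Fin K → Fin N) {F b : ℕ} (split : Fin F ≃ Pair K × Fin b)
    (hH : 2 ≤ #(highUsers Nh d)) :
    ∃ D ε, IsFourStepDelivery Nh P d D ∧ Decodable split P d D ∧ ε ≤ 1 ∧
      2 * #D + (#(highUsers Nh d)).choose 3 = ∑ u, #(missing P d u) + ε := by
  rw [highUsers_eq_compl] at hH
  obtain ⟨δ, w, T, U, h⟩ := exists_isHighPlan hq hH
  obtain ⟨e, he⟩ := (isExchangePlan_share hP h hq).exists_isMatching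
  exact ⟨_, _, isFourStepDelivery_fourStepMessages hP h he hq,
    (delivers_fourStepMessages hP h he hq).decodable Subset.rfl split, h.card_uncoded_le_one,
    card_fourStepMessages hP h he hq⟩

end FourStep

section Rate

variable {q kh kl n ε L : ℕ}

lemma deliveryRate_eq {F b : ℕ} (hb : 0 < b) (split : Fin F ≃ Pair K × Fin b)
    (D : Finset (Message K)) : deliveryRate F b D = #D / K.choose 2 := by
  rw [deliveryRate, card_file_eq split, Nat.cast_mul,
    mul_div_mul_right _ _ (Nat.cast_ne_zero.2 hb.ne')]

lemma cl21Rate_of_two_le (hkh : 2 ≤ kh) (hL : (L : ℚ) = totalMissing K kh kl) (hε : ε ≤ 1)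
    (hn : 2 * n + kh.choose 3 = L + ε) : cl21Rate K kh kl = n / K.choose 2 := by
  have hn : 2 * (n : ℚ) + kh.choose 3 = L + ε := by exact_mod_cast hn
  have hε : (ε : ℚ) ≤ 1 := by exact_mod_cast hε
  have hceil : ⌈((L : ℚ) - 3 * kh.choose 3) / 2⌉ = (n : ℤ) - kh.choose 3 := by
    rw [Int.ceil_eq_iff]
    push_cast
    constructor <;> linarith
  rw [cl21Rate, if_pos hkh, ← hL, hceil]
  push_cast
  rw [add_sub_cancel]

lemma cl21Rate_of_lt_two (hq : K = 2 * q + 1) (hK : 2 ≤ K) (hkh : kh < 2)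
    (hn : n = K.choose 2 * q) : cl21Rate K kh kl = n / K.choose 2 := by
  have hK : (K.choose 2 : ℚ) ≠ 0 := Nat.cast_ne_zero.2 (Nat.choose_pos hK).ne'
  have hq : (K : ℚ) = 2 * q + 1 := by exact_mod_cast hq
  rw [cl21Rate, if_neg hkh.not_ge, hn, Nat.cast_mul, mul_div_cancel_left₀ _ hK, hq]
  ring

end Rate

lemma IsCL21Placement.exists_delivery {Nh F b : ℕ} {P : Placement K N} (hP : IsCL21Placement Nh P)
    (hK : 2 ≤ K) {q : ℕ} (hq : K = 2 * q + 1) (hb : 0 < b) (split : Fin F ≃ Pair K × Fin b)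
    (d : Fin K → Fin N) :
    ∃ D, IsCL21Delivery Nh P d D ∧ Decodable split P d D ∧
      deliveryRate F b D = cl21Rate K #(highUsers Nh d) #(lowUsers Nh d) := by
  rcases le_or_gt 2 #(highUsers Nh d) with hH | hH
  · obtain ⟨D, ε, hD, hdec, hε, hcard⟩ := hP.exists_fourStepDelivery hq d split hH
    exact ⟨D, ⟨fun _ => hD, fun h => absurd hH h.not_ge⟩, hdec, (deliveryRate_eq hb split D).trans
      (cl21Rate_of_two_le hH (hP.sum_card_missing hq d) hε hcard).symm⟩
  · obtain ⟨D, hD, hdec, hcard⟩ := hP.exists_fallbackDelivery hq d split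
    exact ⟨D, ⟨fun h => absurd h hH.not_ge, fun _ => hD⟩, hdec, (deliveryRate_eq hb split D).trans
      (cl21Rate_of_lt_two hq hK hH hcard).symm⟩

end CL21

theorem lemma1 (K N Nh F b : ℕ) (hK : 2 ≤ K) (hdiv : K ∣ K.choose 2) (hN : Nh ≤ N) (hb : 0 < b)
    (split : Fin F ≃ CL21.Pair K × Fin b) :
    (∃ P : CL21.Placement K N, CL21.IsCL21Placement Nh P) ∧
    ∀ P : CL21.Placement K N, CL21.IsCL21Placement Nh P →
      (∀ u : Fin K,
        ((CL21.cachedBits split P u).card : ℚ) = CL21.cacheSize K Nh N 2 * (F : ℚ)) ∧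
      ∀ d : Fin K → Fin N,
        ((∑ u : Fin K, (CL21.missing P d u).card : ℕ) : ℚ) =
          CL21.totalMissing K (CL21.highUsers Nh d).card (CL21.lowUsers Nh d).card ∧
        ∃ D : Finset (CL21.Message K),
          CL21.IsCL21Delivery Nh P d D ∧
          CL21.Decodable split P d D ∧
          CL21.deliveryRate F b D =
            CL21.cl21Rate K (CL21.highUsers Nh d).card (CL21.lowUsers Nh d).card := by
  obtain ⟨q, hq⟩ := CL21.exists_eq_two_mul_add_one (two_pos.trans_le hK) hdiv
  exact ⟨CL21.exists_isCL21Placement hq Nh, fun P hP =>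
    ⟨hP.card_cachedBits_eq_cacheSize_mul hq hN split, fun d =>
      ⟨hP.sum_card_missing hq d, hP.exists_delivery hK hq hb split d⟩⟩⟩
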